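/- For $0\le p\le 1$ let $$\rho_\chi(p,\pi/8)=p\,|\Psi_s\rangle\langle\Psi_s|+(1-p)\,|00\rangle\langle 00|\otimes \tfrac{I_2}{2},\qquad |\Psi_s\rangle=\cos\tfrac{\pi}{8}\,|000\rangle+\sin\tfrac{\pi}{8}\,|111\rangle .$$ The local measurements are those of the qubit observables $g\cdot\sigma=\sum_{k=1}^3 g_k\sigma_k$ ($g\in\mathbb R^3$ a unit vector, $\sigma_k$ the Pauli matrices), with outcomes $\pm1$. A three-qubit state admits a bi-LHV model if its correlations have the form $$P(abc|XYZ)=\int P_\lambda(ab|XY)P_\lambda(c|Z)\,dq_1(\lambda)+\int P_\lambda(ac|XZ)P_\lambda(b|Y)\,dq_2(\lambda)+\int P_\lambda(bc|YZ)P_\lambda(a|X)\,dq_3(\lambda)$$ for all local measurements $X,Y,Z$ and all outcomes $a,b,c$, where $q_1,q_2,q_3$ are measures of total mass $1$ together and every $P_\lambda(\cdot|\cdot)$ is a conditional probability distribution; otherwise it is called genuinely tripartite nonlocal. With observables $A,A',B,B',C,C'$ of the above form, the Svetlichny operators are $$\mathcal S=A\otimes[(B+B')\otimes C+(B-B')\otimes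 C']+A'\otimes[(B-B')\otimes C-(B+B')\otimes C'],$$ and a state $\rho$ violates the Svetlichny inequality if $|\mathrm{tr}(\mathcal S\rho)|>4$ for some $\mathcal S$. For positive operators $F_A,F_B,F_C$ on the qubits, put $F=F_A\otimes F_B\otimes F_C$; if $N=\mathrm{tr}(F\rho F^\dagger)\neq0$, the locally filtered state is $\rho'=F\rho F^\dagger/N$. Then: 1. For $0\le p\le 0.4167$ the state $\rho_\chi(p,\pi/8)$ admits a bi-LHV model. 2. For $0\le p\le 1$, the maximum of $|\mathrm{tr}(\mathcal S\rho_\chi(p,\pi/8))|$ over all Svetlichny operators is attained and equals $4p$; hence $\rho_\chi(p,\pi/8)$ never violates the Svetlichny inequality. 3. For $0.3697\le p\le 1$ there are local filters such that the filtered state of $\rho_\chi(p,\pi/8)$ violates the Svetlichny inequality and is genuinely tripartite nonlocal. 4. Consequently, hidden genuine tripartite nonlocality is revealed for $0.3697\le p\le 0.4167$: the state $\rho_\chi(p,\pi/8)$ admits a bi-LHV model, but some locally filtered state of it violates the Svetlichny inequality and is genuinely tripartite nonlocal. 5. The value $0.3697$ is a numerical approximation, slightly from above, of the exact threshold $(4-\sqrt2)/7=0.36939\ldots$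 for diagonal filters: for $0\le p\le1$ there are $x,y,z\ge0$ for which $F_A=\mathrm{diag}(x,1)$, $F_B=\mathrm{diag}(y,1)$, $F_C=\mathrm{diag}(z,1)$ give a well-defined filtered state of $\rho_\chi(p,\pi/8)$ that violates the Svetlichny inequality if and only if $p>(4-\sqrt2)/7$. -/

import Mathlib

open scoped Kronecker ComplexOrder
open MeasureTheory

noncomputable section

namespace ThreeQubit

/-- Index set of the computational basis `|ijk⟩` of three qubits `A`, `B`, `C`. -/
abbrev Idx : Type := Fin 2 × Fin 2 × Fin 2

/-- Operators on one qubit. -/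
abbrev Op1 : Type := Matrix (Fin 2) (Fin 2) ℂ

/-- Operators on three qubits. -/
abbrev Op3 : Type := Matrix Idx Idx ℂ

/-- The tensor product `A ⊗ B ⊗ C`. -/
def tensor (A B C : Op1) : Op3 := A ⊗ₖ (B ⊗ₖ C)

/-- The standard Pauli matrices `σ₁, σ₂, σ₃`. -/
def pauli : Fin 3 → Op1 :=
  ![!![0, 1; 1, 0], !![0, -Complex.I; Complex.I, 0], !![1, 0; 0, -1]]

/-- Unit vectors of three-dimensional real Euclidean space: the measurement directions. -/
abbrev Direction : Type := Metric.sphere (0 : EuclideanSpace ℝ (Fin 3)) 1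

/-- The qubit observable `g · σ = ∑ₖ gₖ σₖ`, with outcomes `±1`. -/
def obs (g : Direction) : Op1 := ∑ k : Fin 3, ((g.1 k : ℝ) : ℂ) • pauli k

/-- The spectral projection of `g · σ` onto the outcome `a ∈ {1, -1}`. -/
def proj (g : Direction) (a : ℤˣ) : Op1 := (1 / 2 : ℂ) • (1 + ((a : ℤ) : ℂ) • obs g)

/-- The (Born) probability `P(abc|xyz)` of the outcomes `a, b, c ∈ {1, -1}` when the observables
`x · σ`, `y · σ`, `z · σ` are measured on the three qubits in the state `ρ`. -/
def bornProb (ρ : Op3) (x y z : Direction) (a b c : ℤˣ) : ℝ :=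
  (Matrix.trace (ρ * tensor (proj x a) (proj y b) (proj z c))).re

/-- `f` is a probability distribution on the finite set `ι`. -/
def IsProbDist {ι : Type} [Fintype ι] (f : ι → ℝ) : Prop :=
  (∀ i, 0 ≤ f i) ∧ ∑ i, f i = 1

/-- A measurable family, indexed by a hidden variable, of conditional outcome distributions of one
party: `P l x a` is `P_l(a|x)`. -/
def IsLocalResponse {Λ : Type} [MeasurableSpace Λ] (P : Λ → Direction → ℤˣ → ℝ) : Prop :=
  (∀ l x, IsProbDist (P l x)) ∧ ∀ x a, Measurable fun l => P l x a

/-- A measurable family, indexed by a hidden variable, of joint conditional outcome distributions of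
two parties, otherwise unrestricted: `P l x y (a, b)` is `P_l(ab|xy)`. -/
def IsPairResponse {Λ : Type} [MeasurableSpace Λ]
    (P : Λ → Direction → Direction → ℤˣ × ℤˣ → ℝ) : Prop :=
  (∀ l x y, IsProbDist (P l x y)) ∧ ∀ x y ab, Measurable fun l => P l x y ab

/-- The state `ρ` admits a bi-LHV model: the correlations of all local measurements are a convex
mixture of correlations that factorize, given a hidden variable, across `AB|C`, `AC|B` or `BC|A`.
The three measures carry the weights `q_λ`, `q_μ`, `q_ν` of the three kinds of terms; their total
mass is one. A discrete hidden variable (sums instead of integrals) is a special case. -/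
def AdmitsBiLHV (ρ : Op3) : Prop :=
  ∃ (Λ : Type) (_ : MeasurableSpace Λ) (q₁ q₂ q₃ : Measure Λ)
    (PAB PAC PBC : Λ → Direction → Direction → ℤˣ × ℤˣ → ℝ)
    (PA PB PC : Λ → Direction → ℤˣ → ℝ),
    q₁ Set.univ + q₂ Set.univ + q₃ Set.univ = 1 ∧
    IsPairResponse PAB ∧ IsPairResponse PAC ∧ IsPairResponse PBC ∧
    IsLocalResponse PA ∧ IsLocalResponse PB ∧ IsLocalResponse PC ∧
    ∀ (x y z : Direction) (a b c : ℤˣ),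
      bornProb ρ x y z a b c =
        (∫ l, PAB l x y (a, b) * PC l z c ∂q₁) +
        (∫ l, PAC l x z (a, c) * PB l y b ∂q₂) +
        (∫ l, PBC l y z (b, c) * PA l x a ∂q₃)

/-- Genuine tripartite nonlocality: there is no bi-LHV model. -/
def GenuinelyNonlocal (ρ : Op3) : Prop := ¬ AdmitsBiLHV ρ

/-- The Svetlichny operator
`A ⊗ [(B+B') ⊗ C + (B-B') ⊗ C'] + A' ⊗ [(B-B') ⊗ C - (B+B') ⊗ C']`
of the observables in the directions `a, a', b, b', c, c'`. -/
def svetlichny (a a' b b' c c' : Direction) : Op3 :=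
  tensor (obs a) (obs b + obs b') (obs c) + tensor (obs a) (obs b - obs b') (obs c') +
    (tensor (obs a') (obs b - obs b') (obs c) - tensor (obs a') (obs b + obs b') (obs c'))

/-- The set of all values `|⟨S⟩_ρ| = |tr(S ρ)|`, with `S` ranging over the Svetlichny operators. -/
def svetlichnyValues (ρ : Op3) : Set ℝ :=
  {v | ∃ a a' b b' c c' : Direction, v = ‖Matrix.trace (svetlichny a a' b b' c c' * ρ)‖}

/-- `ρ` violates the Svetlichny inequality `|⟨S⟩_ρ| ≤ 4` for some choice of observables. -/
def ViolatesSvetlichny (ρ : Op3) : Prop := ∃ v ∈ svetlichnyValues ρ, 4 < v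

/-- The normalization factor `N = tr[(F_A ⊗ F_B ⊗ F_C) ρ (F_A ⊗ F_B ⊗ F_C)†]`. -/
def filterNorm (FA FB FC : Op1) (ρ : Op3) : ℂ :=
  Matrix.trace (tensor FA FB FC * ρ * (tensor FA FB FC).conjTranspose)

/-- The locally filtered state `ρ' = (1/N) (F_A ⊗ F_B ⊗ F_C) ρ (F_A ⊗ F_B ⊗ F_C)†`;
meaningful only when `N ≠ 0`. -/
def filtered (FA FB FC : Op1) (ρ : Op3) : Op3 :=
  (filterNorm FA FB FC ρ)⁻¹ • (tensor FA FB FC * ρ * (tensor FA FB FC).conjTranspose)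

/-- `FA, FB, FC` are admissible local filters for `ρ`: positive operators for which the filtered
state is defined. -/
def IsLocalFilter (FA FB FC : Op1) (ρ : Op3) : Prop :=
  FA.PosSemidef ∧ FB.PosSemidef ∧ FC.PosSemidef ∧ filterNorm FA FB FC ρ ≠ 0

/-- The diagonal filter `diag(t, 1)`. -/
def diagFilter (t : ℝ) : Op1 := !![(t : ℂ), 0; 0, 1]

/-- The vector `|Ψ_s⟩ = cos θ |000⟩ + sin θ |111⟩`. -/
def ghzVec (θ : ℝ) : Idx → ℂ := fun i =>
  if i = (0, 0, 0) then (Real.cos θ : ℂ) else if i = (1, 1, 1) then (Real.sin θ : ℂ) else 0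

/-- The projection `|0⟩⟨0|`. -/
def ketbraZero : Op1 := !![1, 0; 0, 0]

/-- The state `ρ_χ(p,θ) = p |Ψ_s⟩⟨Ψ_s| + (1-p) |00⟩⟨00| ⊗ I/2`. -/
def rhoChi (p θ : ℝ) : Op3 :=
  (p : ℂ) • Matrix.vecMulVec (ghzVec θ) (star (ghzVec θ)) +
    ((1 - p : ℝ) : ℂ) • tensor ketbraZero ketbraZero ((1 / 2 : ℂ) • (1 : Op1))

end ThreeQubit

end

/-!
The argument has three independent parts.

*Bi-local model.* On the span of `|00⟩` and `|11⟩`, which carries the qubits `A`, `B` of `ρ_χ`, every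
joint effect of two local projective measurements has rank one, so an outcome pair `ab` leaves `C`, in
the entangled component, in a pure unnormalized state with Bloch vector `V_ab` (`steeredVec`,
`norm_steeredVec`). The hidden variable is a direction `λ`, and `C` answers with the sign of `⟨z, λ⟩`.
For uniform `λ` this sign correlates with an odd function of `λ` only, and with `⟨V, λ⟩` as
`κ ⟨V, z⟩`, where `κ` is the mean of `|⟨e, λ⟩|` (`integral_inner_mul_sign`). Hence the joint density
of `λ` and `ab` must have the odd part `(p/κ) ⟨V_ab, λ⟩`. Adding `(p/κ) |⟨V_ab, λ⟩|` makes this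
nonnegative with exactly the weight of the entangled component; the remaining density is even in `λ`,
and is given to the outcomes as in the state `|00⟩`, which yields the noise `|00⟩⟨00| ⊗ I/2`
(`jointDensity`). It is nonnegative as soon as `p ≤ κ`, since `∑ |V_ab| = 1`. The sum over `ab` is a
positive density for `λ`, tilted along the `z`-axis (`hiddenDensity`). In fact `κ = 1/2`; the bound
`κ ≥ 58/135 > 0.4167` from second and fourth moments suffices (`le_meanAbs`).

*Svetlichny values.* The three-qubit correlators of `ρ_χ` and of its diagonally filtered versions are
`P x₃y₃z₃ + Q Re((x₁+ix₂)(y₁+iy₂)(z₁+iz₂))`. Unfolded as a `3 × 9` matrix this tensor has the singular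
values `|P|` and `√2 |Q|` (twice), and the Cauchy-Schwarz inequality bounds the Svetlichny sum by
`4 max(|P|, √2 |Q|)` (`abs_svetlichnySum_corr_le`); in the `xy`-plane `4 √2 |Q|` is attained. Before
filtering `P = Q = p/√2`. After filtering `|P| ≤ 1` always, so that a violation means
`p xyz > N`, a quadratic condition on `xyz` which is solvable, in the limit `xy → 0`, iff its
discriminant is positive (`exists_diagFilter_iff`).

*Genuine nonlocality.* For each value of the hidden variable in a bi-local model the Svetlichny sum is
at most `4` in modulus (`abs_bilocal_le`), hence so is the mixture, and a violation excludes a model.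
-/

open scoped Kronecker ComplexOrder
open MeasureTheory

namespace ThreeQubit

/-! ### Traces of product operators -/

/-- The unnormalized state
`p (u|000⟩ + v|111⟩)(u⟨000| + v⟨111|) + |00⟩⟨00| ⊗ diag(s, t)`. The states `ρ_χ(p,θ)` have this form,
and local diagonal filtering preserves it. -/
noncomputable def coreOp (p u v s t : ℝ) : Op3 :=
  (p : ℂ) • Matrix.vecMulVec
      (fun i : Idx => if i = (0, 0, 0) then (u : ℂ) else if i = (1, 1, 1) then (v : ℂ) else 0)
      (star fun i : Idx => if i = (0, 0, 0) then (u : ℂ) else if i = (1, 1, 1) then (v : ℂ) else 0) +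
    tensor ketbraZero ketbraZero !![(s : ℂ), 0; 0, (t : ℂ)]

lemma rhoChi_eq_coreOp (p θ : ℝ) :
    rhoChi p θ = coreOp p (Real.cos θ) (Real.sin θ) ((1 - p) / 2) ((1 - p) / 2) := by
  unfold rhoChi coreOp ghzVec
  congr 1
  ext ⟨i, j, k⟩ ⟨i', j', k'⟩
  fin_cases k <;> fin_cases k' <;> simp [tensor, Matrix.kroneckerMap_apply] <;> ring

lemma trace_tensor_mul_tensor (A B C A' B' C' : Op1) :
    Matrix.trace (tensor A B C * tensor A' B' C') =
      Matrix.trace (A * A') * (Matrix.trace (B * B') * Matrix.trace (C * C')) := by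
  simp only [tensor, ← Matrix.mul_kronecker_mul, Matrix.trace_kronecker]

lemma trace_tensor_mul_coreOp (A B C : Op1) (p u v s t : ℝ) :
    Matrix.trace (tensor A B C * coreOp p u v s t) =
      p * (u ^ 2 * (A 0 0 * B 0 0 * C 0 0) +
          u * v * (A 0 1 * B 0 1 * C 0 1 + A 1 0 * B 1 0 * C 1 0) +
          v ^ 2 * (A 1 1 * B 1 1 * C 1 1)) +
        A 0 0 * B 0 0 * (s * C 0 0 + t * C 1 1) := by
  unfold coreOp
  rw [mul_add, Matrix.trace_add, trace_tensor_mul_tensor, Matrix.mul_smul, Matrix.trace_smul,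
    Matrix.mul_vecMulVec, Matrix.trace_vecMulVec]
  simp only [dotProduct, Matrix.mulVec, Fintype.sum_prod_type, Fin.sum_univ_two, tensor,
    Matrix.kroneckerMap_apply, Pi.star_apply, Prod.mk.injEq, Matrix.trace, Matrix.diag,
    Matrix.mul_apply, ketbraZero]
  simp
  ring

lemma trace_coreOp (p u v s t : ℝ) :
    Matrix.trace (coreOp p u v s t) = ((p * (u ^ 2 + v ^ 2) + (s + t) : ℝ) : ℂ) := by
  have h := trace_tensor_mul_coreOp 1 1 1 p u v s t
  rw [show tensor 1 1 1 = 1 by simp [tensor], one_mul] at h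
  rw [h]
  simp

/-- Diagonal filters act within the family `coreOp`. -/
lemma diagFilter_conj_coreOp (x y z p u v s t : ℝ) :
    tensor (diagFilter x) (diagFilter y) (diagFilter z) * coreOp p u v s t *
        (tensor (diagFilter x) (diagFilter y) (diagFilter z)).conjTranspose =
      coreOp p (x * y * z * u) v (x ^ 2 * y ^ 2 * z ^ 2 * s) (x ^ 2 * y ^ 2 * t) := by
  have hF : (tensor (diagFilter x) (diagFilter y) (diagFilter z)).conjTranspose =
      tensor (diagFilter x) (diagFilter y) (diagFilter z) := by
    have h : ∀ w : ℝ, (diagFilter w).conjTranspose = diagFilter w := fun w => by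
      ext i j
      fin_cases i <;> fin_cases j <;> simp [diagFilter]
    simp only [tensor, Matrix.conjTranspose_kronecker, h]
  have hd : ∀ w : ℝ, diagFilter w = Matrix.diagonal ![(w : ℂ), 1] := fun w => by
    ext i j
    fin_cases i <;> fin_cases j <;> simp [diagFilter]
  rw [hF]
  simp only [tensor, hd, Matrix.diagonal_kronecker_diagonal]
  ext ⟨i, j, k⟩ ⟨i', j', k'⟩
  rw [Matrix.mul_diagonal, Matrix.diagonal_mul]
  simp only [coreOp, tensor, Matrix.add_apply, Matrix.smul_apply, Matrix.vecMulVec_apply,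
    Matrix.kroneckerMap_apply, Pi.star_apply, Prod.mk.injEq, ketbraZero]
  fin_cases i <;> fin_cases j <;> fin_cases k <;> simp <;>
  fin_cases i' <;> fin_cases j' <;> fin_cases k' <;> simp <;> ring

lemma filterNorm_coreOp (x y z p u v s t : ℝ) :
    filterNorm (diagFilter x) (diagFilter y) (diagFilter z) (coreOp p u v s t) =
      ((p * ((x * y * z * u) ^ 2 + v ^ 2) +
        (x ^ 2 * y ^ 2 * z ^ 2 * s + x ^ 2 * y ^ 2 * t) : ℝ) : ℂ) := by
  rw [filterNorm, diagFilter_conj_coreOp, trace_coreOp]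

lemma obs_apply (g : Direction) :
    obs g = !![(g.1 2 : ℂ), (g.1 0 : ℂ) - (g.1 1 : ℂ) * Complex.I;
      (g.1 0 : ℂ) + (g.1 1 : ℂ) * Complex.I, -(g.1 2 : ℂ)] := by
  ext i j
  fin_cases i <;> fin_cases j <;> simp [obs, pauli, Fin.sum_univ_three, sub_eq_add_neg]

lemma proj_apply (g : Direction) (a : ℤˣ) :
    proj g a = !![(1 + ((a : ℤ) : ℂ) * g.1 2) / 2,
        ((a : ℤ) : ℂ) * ((g.1 0 : ℂ) - (g.1 1 : ℂ) * Complex.I) / 2;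
      ((a : ℤ) : ℂ) * ((g.1 0 : ℂ) + (g.1 1 : ℂ) * Complex.I) / 2,
        (1 - ((a : ℤ) : ℂ) * g.1 2) / 2] := by
  rw [proj, obs_apply]
  ext i j
  fin_cases i <;> fin_cases j <;> simp <;> ring

lemma Direction.sum_sq (g : Direction) : g.1 0 ^ 2 + g.1 1 ^ 2 + g.1 2 ^ 2 = 1 := by
  have h : ‖g.1‖ = 1 := by simp
  have := EuclideanSpace.norm_sq_eq g.1
  rw [h, Fin.sum_univ_three] at this
  simpa using this.symm

/-- The correlator `P x₃y₃z₃ + Q Re((x₁+ix₂)(y₁+iy₂)(z₁+iz₂))`. -/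
def corr (P Q : ℝ) (x y z : Direction) : ℝ :=
  P * (x.1 2 * y.1 2 * z.1 2) +
    Q * ((x.1 0 * y.1 0 - x.1 1 * y.1 1) * z.1 0 - (x.1 0 * y.1 1 + x.1 1 * y.1 0) * z.1 1)

lemma trace_obs_mul_coreOp (x y z : Direction) (p u v s t : ℝ) :
    Matrix.trace (tensor (obs x) (obs y) (obs z) * coreOp p u v s t) =
      (corr (p * (u ^ 2 - v ^ 2) + (s - t)) (2 * p * (u * v)) x y z : ℂ) := by
  rw [trace_tensor_mul_coreOp, obs_apply, obs_apply, obs_apply, corr]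
  simp
  ring_nf
  simp only [Complex.I_sq]
  ring

lemma filtered_coreOp_corr (x y z : Direction) (a b c p u v s t : ℝ) :
    let N := p * ((a * b * c * u) ^ 2 + v ^ 2) +
        (a ^ 2 * b ^ 2 * c ^ 2 * s + a ^ 2 * b ^ 2 * t)
    Matrix.trace (tensor (obs x) (obs y) (obs z) *
        filtered (diagFilter a) (diagFilter b) (diagFilter c) (coreOp p u v s t)) =
      (corr ((p * ((a * b * c * u) ^ 2 - v ^ 2) +
        (a ^ 2 * b ^ 2 * c ^ 2 * s - a ^ 2 * b ^ 2 * t)) / N)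
        (2 * p * (a * b * c * (u * v)) / N) x y z : ℂ) := by
  intro N
  rw [filtered, Matrix.mul_smul, Matrix.trace_smul, diagFilter_conj_coreOp, trace_obs_mul_coreOp,
    filterNorm_coreOp, smul_eq_mul, ← Complex.ofReal_inv, ← Complex.ofReal_mul]
  congr 1
  simp only [corr]
  change N⁻¹ * _ = _
  ring

/-! ### The Svetlichny polynomial -/

/-- The Svetlichny combination of the eight correlators. -/
def svetlichnySum (E : Direction → Direction → Direction → ℝ) (a a' b b' c c' : Direction) : ℝ :=
  E a b c + E a b' c + E a b c' - E a b' c' + E a' b c - E a' b' c - E a' b c' - E a' b' c'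

lemma trace_svetlichny_mul (ρ : Op3) (E : Direction → Direction → Direction → ℝ)
    (hE : ∀ x y z, Matrix.trace (tensor (obs x) (obs y) (obs z) * ρ) = (E x y z : ℂ))
    (a a' b b' c c' : Direction) :
    Matrix.trace (svetlichny a a' b b' c c' * ρ) = (svetlichnySum E a a' b b' c c' : ℂ) := by
  have hadd : ∀ A B B' C : Op1, tensor A (B + B') C = tensor A B C + tensor A B' C := by
    intro A B B' C
    simp [tensor, Matrix.add_kronecker, Matrix.kronecker_add]
  have hsub : ∀ A B B' C : Op1, tensor A (B - B') C = tensor A B C - tensor A B' C := by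
    intro A B B' C
    rw [eq_sub_iff_add_eq, ← hadd, sub_add_cancel]
  simp only [svetlichny, hadd, hsub, add_mul, sub_mul, Matrix.trace_add, Matrix.trace_sub, hE,
    svetlichnySum]
  push_cast
  ring

/-- The contraction of `corr P Q` with a tensor `t` in the first and third slot is a vector no longer
than `t`, if `|P| ≤ 1` and `√2 |Q| ≤ 1`: the singular values of this unfolding are `|P|` and `√2 |Q|`. -/
lemma unfolding_norm_le {P Q : ℝ} (hP : P ^ 2 ≤ 1) (hQ : 2 * Q ^ 2 ≤ 1)
    (t₁₁ t₁₂ t₁₃ t₂₁ t₂₂ t₂₃ t₃₁ t₃₂ t₃₃ : ℝ) :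
    (Q * (t₁₁ - t₂₂)) ^ 2 + (Q * (t₁₂ + t₂₁)) ^ 2 + (P * t₃₃) ^ 2 ≤
      t₁₁ ^ 2 + t₁₂ ^ 2 + t₁₃ ^ 2 + t₂₁ ^ 2 + t₂₂ ^ 2 + t₂₃ ^ 2 + t₃₁ ^ 2 + t₃₂ ^ 2 + t₃₃ ^ 2 := by
  have h1 := mul_le_mul_of_nonneg_right hP (sq_nonneg t₃₃)
  have h2 := mul_le_mul_of_nonneg_right hQ
    (add_nonneg (add_nonneg (sq_nonneg t₁₁) (sq_nonneg t₂₂)) (add_nonneg (sq_nonneg t₁₂) (sq_nonneg t₂₁)))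
  have h3 := mul_nonneg (sq_nonneg Q) (sq_nonneg (t₁₁ + t₂₂))
  have h4 := mul_nonneg (sq_nonneg Q) (sq_nonneg (t₁₂ - t₂₁))
  nlinarith [sq_nonneg t₁₃, sq_nonneg t₂₃, sq_nonneg t₃₁, sq_nonneg t₃₂]

lemma cauchy_schwarz_six (x₁ x₂ x₃ x₄ x₅ x₆ y₁ y₂ y₃ y₄ y₅ y₆ : ℝ) :
    (x₁ * y₁ + x₂ * y₂ + x₃ * y₃ + x₄ * y₄ + x₅ * y₅ + x₆ * y₆) ^ 2 ≤
      (x₁ ^ 2 + x₂ ^ 2 + x₃ ^ 2 + x₄ ^ 2 + x₅ ^ 2 + x₆ ^ 2) *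
        (y₁ ^ 2 + y₂ ^ 2 + y₃ ^ 2 + y₄ ^ 2 + y₅ ^ 2 + y₆ ^ 2) := by
  have h := Finset.sum_mul_sq_le_sq_mul_sq Finset.univ ![x₁, x₂, x₃, x₄, x₅, x₆]
    ![y₁, y₂, y₃, y₄, y₅, y₆]
  simpa [Fin.sum_univ_six] using h

/-- With `w = u(a,c) - u(a',c')` and `w' = u(a,c') + u(a',c)`, where `u` is the contraction of the
correlator in its first and third slot, the Svetlichny sum is `(b + b')·w + (b - b')·w'`. Here
`|b + b'|² + |b - b'|² = 4`, and `|w|² + |w'|² ≤ |a⊗c - a'⊗c'|² + |a⊗c' + a'⊗c|² = 4`. -/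
lemma abs_svetlichnySum_corr_le {P Q : ℝ} (hP : P ^ 2 ≤ 1) (hQ : 2 * Q ^ 2 ≤ 1)
    (a a' b b' c c' : Direction) : |svetlichnySum (corr P Q) a a' b b' c c'| ≤ 4 := by
  have ha := a.sum_sq
  have ha' := a'.sum_sq
  have hb := b.sum_sq
  have hb' := b'.sum_sq
  have hc := c.sum_sq
  have hc' := c'.sum_sq
  simp only [svetlichnySum, corr]
  generalize a.1 0 = a₁ at *
  generalize a.1 1 = a₂ at *
  generalize a.1 2 = a₃ at *
  generalize a'.1 0 = a₁' at *
  generalize a'.1 1 = a₂' at *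
  generalize a'.1 2 = a₃' at *
  generalize b.1 0 = b₁ at *
  generalize b.1 1 = b₂ at *
  generalize b.1 2 = b₃ at *
  generalize b'.1 0 = b₁' at *
  generalize b'.1 1 = b₂' at *
  generalize b'.1 2 = b₃' at *
  generalize c.1 0 = c₁ at *
  generalize c.1 1 = c₂ at *
  generalize c.1 2 = c₃ at *
  generalize c'.1 0 = c₁' at *
  generalize c'.1 1 = c₂' at *
  generalize c'.1 2 = c₃' at *
  have hw := unfolding_norm_le hP hQ (a₁ * c₁ - a₁' * c₁') (a₁ * c₂ - a₁' * c₂')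
    (a₁ * c₃ - a₁' * c₃') (a₂ * c₁ - a₂' * c₁') (a₂ * c₂ - a₂' * c₂') (a₂ * c₃ - a₂' * c₃')
    (a₃ * c₁ - a₃' * c₁') (a₃ * c₂ - a₃' * c₂') (a₃ * c₃ - a₃' * c₃')
  have hw' := unfolding_norm_le hP hQ (a₁ * c₁' + a₁' * c₁) (a₁ * c₂' + a₁' * c₂)
    (a₁ * c₃' + a₁' * c₃) (a₂ * c₁' + a₂' * c₁) (a₂ * c₂' + a₂' * c₂) (a₂ * c₃' + a₂' * c₃)
    (a₃ * c₁' + a₃' * c₁) (a₃ * c₂' + a₃' * c₂) (a₃ * c₃' + a₃' * c₃)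
  have hcs := cauchy_schwarz_six (b₁ + b₁') (b₂ + b₂') (b₃ + b₃') (b₁ - b₁') (b₂ - b₂') (b₃ - b₃')
    (Q * ((a₁ * c₁ - a₁' * c₁') - (a₂ * c₂ - a₂' * c₂')))
    (-(Q * ((a₁ * c₂ - a₁' * c₂') + (a₂ * c₁ - a₂' * c₁')))) (P * (a₃ * c₃ - a₃' * c₃'))
    (Q * ((a₁ * c₁' + a₁' * c₁) - (a₂ * c₂' + a₂' * c₂)))
    (-(Q * ((a₁ * c₂' + a₁' * c₂) + (a₂ * c₁' + a₂' * c₁)))) (P * (a₃ * c₃' + a₃' * c₃))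
  have hB : (b₁ + b₁') ^ 2 + (b₂ + b₂') ^ 2 + (b₃ + b₃') ^ 2 + (b₁ - b₁') ^ 2 + (b₂ - b₂') ^ 2 +
      (b₃ - b₃') ^ 2 = 4 := by linear_combination 2 * hb + 2 * hb'
  have hAC : ((a₁ * c₁ - a₁' * c₁') ^ 2 + (a₁ * c₂ - a₁' * c₂') ^ 2 + (a₁ * c₃ - a₁' * c₃') ^ 2 +
      (a₂ * c₁ - a₂' * c₁') ^ 2 + (a₂ * c₂ - a₂' * c₂') ^ 2 + (a₂ * c₃ - a₂' * c₃') ^ 2 +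
      (a₃ * c₁ - a₃' * c₁') ^ 2 + (a₃ * c₂ - a₃' * c₂') ^ 2 + (a₃ * c₃ - a₃' * c₃') ^ 2) +
      ((a₁ * c₁' + a₁' * c₁) ^ 2 + (a₁ * c₂' + a₁' * c₂) ^ 2 + (a₁ * c₃' + a₁' * c₃) ^ 2 +
      (a₂ * c₁' + a₂' * c₁) ^ 2 + (a₂ * c₂' + a₂' * c₂) ^ 2 + (a₂ * c₃' + a₂' * c₃) ^ 2 +
      (a₃ * c₁' + a₃' * c₁) ^ 2 + (a₃ * c₂' + a₃' * c₂) ^ 2 + (a₃ * c₃' + a₃' * c₃) ^ 2) = 4 := by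
    linear_combination (c₁ ^ 2 + c₂ ^ 2 + c₃ ^ 2 + (c₁' ^ 2 + c₂' ^ 2 + c₃' ^ 2)) * (ha + ha') +
      2 * hc + 2 * hc'
  rw [hB] at hcs
  refine abs_le_of_sq_le_sq (le_trans (le_of_eq ?_) (hcs.trans ?_)) (by norm_num)
  · ring
  · linarith

/-- Equality in the `xy`-plane. -/
lemma exists_svetlichnySum_corr_eq (P Q : ℝ) :
    ∃ a a' b b' c c' : Direction,
      svetlichnySum (corr P Q) a a' b b' c c' = 4 * (√2 * Q) := by
  have mk : ∀ x y : ℝ, x ^ 2 + y ^ 2 = 1 → ∃ g : Direction, g.1 0 = x ∧ g.1 1 = y ∧ g.1 2 = 0 := by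
    intro x y h
    refine ⟨⟨!₂[x, y, 0], ?_⟩, by simp, by simp, by simp⟩
    simp [EuclideanSpace.norm_eq, Fin.sum_univ_three, h]
  have h2 : √2 ^ 2 = (2 : ℝ) := Real.sq_sqrt (by norm_num)
  -- In the plane the correlator is `Q cos(α + β + γ)`; the angles are `0, π/2` for the first and third
  -- party and `∓π/4` for the second.
  obtain ⟨e, he0, he1, he2⟩ := mk 1 0 (by norm_num)
  obtain ⟨f, hf0, hf1, hf2⟩ := mk 0 1 (by norm_num)
  obtain ⟨g, hg0, hg1, hg2⟩ := mk (√2 / 2) (-(√2 / 2)) (by linear_combination h2 / 2)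
  obtain ⟨h, hh0, hh1, hh2⟩ := mk (√2 / 2) (√2 / 2) (by linear_combination h2 / 2)
  refine ⟨e, f, g, h, e, f, ?_⟩
  simp only [svetlichnySum, corr, he0, he1, he2, hf0, hf1, hf2, hg0, hg1, hg2, hh0, hh1, hh2]
  ring

/-! ### Bi-local models obey the Svetlichny inequality -/

lemma sum_intUnits {M : Type*} [AddCommMonoid M] (f : ℤˣ → M) : ∑ a, f a = f 1 + f (-1) := by
  rw [show (Finset.univ : Finset ℤˣ) = {1, -1} from rfl, Finset.sum_pair (by decide)]

/-- The expectation of the product of three `±1`-valued outcomes. -/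
def expect3 (F : ℤˣ → ℤˣ → ℤˣ → ℝ) : ℝ :=
  F 1 1 1 - F 1 1 (-1) - F 1 (-1) 1 + F 1 (-1) (-1) - F (-1) 1 1 + F (-1) 1 (-1) +
    F (-1) (-1) 1 - F (-1) (-1) (-1)

lemma expect3_bornProb (ρ : Op3) (x y z : Direction) :
    expect3 (bornProb ρ x y z) = (Matrix.trace (tensor (obs x) (obs y) (obs z) * ρ)).re := by
  have h : ∀ g : Direction, obs g = proj g 1 - proj g (-1) := by
    intro g
    ext i j
    simp only [proj, Matrix.sub_apply, Matrix.smul_apply, Matrix.add_apply, smul_eq_mul]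
    push_cast
    ring
  have hsub : ∀ A B : Op1, A - B = A + (-1 : ℂ) • B := fun A B => by simp [sub_eq_add_neg]
  rw [Matrix.trace_mul_comm]
  simp only [h x, h y, h z, hsub, expect3, bornProb, tensor, Matrix.add_kronecker,
    Matrix.kronecker_add, Matrix.smul_kronecker, Matrix.kronecker_smul, mul_add, Matrix.trace_add,
    Matrix.mul_smul, Matrix.trace_smul, smul_add, smul_eq_mul, Complex.add_re, neg_mul, one_mul,
    Complex.neg_re, neg_neg, mul_neg]
  ring

lemma abs_le_one_of_isProbDist {f : ℤˣ → ℝ} (h : IsProbDist f) : |f 1 - f (-1)| ≤ 1 := by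
  obtain ⟨h0, h1⟩ := h
  rw [sum_intUnits] at h1
  have := h0 1
  have := h0 (-1)
  rw [abs_le]
  constructor <;> linarith

lemma abs_le_one_of_isProbDist_prod {f : ℤˣ × ℤˣ → ℝ} (h : IsProbDist f) :
    |f (1, 1) - f (1, -1) - f (-1, 1) + f (-1, -1)| ≤ 1 := by
  obtain ⟨h0, h1⟩ := h
  rw [Fintype.sum_prod_type, sum_intUnits, sum_intUnits, sum_intUnits] at h1
  have := h0 (1, 1)
  have := h0 (1, -1)
  have := h0 (-1, 1)
  have := h0 (-1, -1)
  rw [abs_le]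
  constructor <;> linarith

lemma IsProbDist.abs_apply_le {ι : Type} [Fintype ι] {f : ι → ℝ} (h : IsProbDist f) (i : ι) :
    |f i| ≤ 1 := by
  rw [abs_of_nonneg (h.1 i), ← h.2]
  exact Finset.single_le_sum (fun j _ => h.1 j) (Finset.mem_univ i)

/-- The bound behind the Svetlichny inequality: one party holds the numbers `s, t` and the pair
of the other two is unrestricted. -/
lemma abs_bilocal_le {e₁ e₂ e₃ e₄ s t : ℝ} (h₁ : |e₁| ≤ 1) (h₂ : |e₂| ≤ 1) (h₃ : |e₃| ≤ 1)
    (h₄ : |e₄| ≤ 1) (hs : |s| ≤ 1) (ht : |t| ≤ 1) :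
    |e₁ * (s + t) + e₂ * (s - t) + e₃ * (s - t) - e₄ * (s + t)| ≤ 4 := by
  have hst : |s + t| + |s - t| ≤ 2 := by
    rw [abs_le] at hs ht
    rcases abs_cases (s + t) with h | h <;> rcases abs_cases (s - t) with h' | h' <;> linarith
  have h14 : |(e₁ - e₄) * (s + t)| ≤ 2 * |s + t| := by
    rw [abs_mul]
    exact mul_le_mul_of_nonneg_right ((abs_sub _ _).trans (by linarith)) (abs_nonneg _)
  have h23 : |(e₂ + e₃) * (s - t)| ≤ 2 * |s - t| := by
    rw [abs_mul]
    exact mul_le_mul_of_nonneg_right ((abs_add_le _ _).trans (by linarith)) (abs_nonneg _)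
  calc _ = |(e₁ - e₄) * (s + t) + (e₂ + e₃) * (s - t)| := by congr 1; ring
    _ ≤ _ := abs_add_le _ _
    _ ≤ 4 := by linarith

lemma integral_signed_sum {Λ : Type} [MeasurableSpace Λ] (q : Measure Λ) (e : Fin 8 → ℝ)
    (f : Fin 8 → Λ → ℝ) (hf : ∀ i, Integrable (f i) q) :
    Integrable (fun l => ∑ i, e i * f i l) q ∧
      ∫ l, ∑ i, e i * f i l ∂q = ∑ i, e i * ∫ l, f i l ∂q := by
  refine ⟨integrable_finsetSum _ fun i _ => (hf i).const_mul _, ?_⟩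
  rw [integral_finsetSum _ fun i _ => (hf i).const_mul _]
  simp only [integral_const_mul]

/-- One group of terms of a bi-local model: if the Svetlichny sum of the correlators `E l` is at most
`4` for every hidden variable `l`, then that of their integral is at most `4` times the total mass. -/
lemma abs_svetlichnySum_integral_le {Λ : Type} [MeasurableSpace Λ] (q : Measure Λ)
    [IsFiniteMeasure q] (F : Λ → Direction → Direction → Direction → ℤˣ → ℤˣ → ℤˣ → ℝ)
    (hF : ∀ x y z a b c, Integrable (fun l => F l x y z a b c) q) (a a' b b' c c' : Direction)
    (h : ∀ l, |svetlichnySum (fun x y z => expect3 (F l x y z)) a a' b b' c c'| ≤ 4) :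
    |svetlichnySum (fun x y z => expect3 fun i j k => ∫ l, F l x y z i j k ∂q) a a' b b' c c'| ≤
      4 * q.real Set.univ := by
  have hex : ∀ x y z, Integrable (fun l => expect3 (F l x y z)) q ∧
      ∫ l, expect3 (F l x y z) ∂q = expect3 fun i j k => ∫ l, F l x y z i j k ∂q := by
    intro x y z
    have h := integral_signed_sum q ![1, -1, -1, 1, -1, 1, 1, -1]
      ![fun l => F l x y z 1 1 1, fun l => F l x y z 1 1 (-1), fun l => F l x y z 1 (-1) 1,
        fun l => F l x y z 1 (-1) (-1), fun l => F l x y z (-1) 1 1, fun l => F l x y z (-1) 1 (-1),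
        fun l => F l x y z (-1) (-1) 1, fun l => F l x y z (-1) (-1) (-1)]
      (by intro i; fin_cases i <;> exact hF _ _ _ _ _ _)
    simpa [Fin.sum_univ_eight, expect3, sub_eq_add_neg] using h
  have hsv : svetlichnySum (fun x y z => expect3 fun i j k => ∫ l, F l x y z i j k ∂q)
        a a' b b' c c' =
      ∫ l, svetlichnySum (fun x y z => expect3 (F l x y z)) a a' b b' c c' ∂q := by
    simp only [← (hex _ _ _).2]
    generalize hG : (fun l x y z => expect3 (F l x y z)) = G
    have hG' : ∀ l x y z, expect3 (F l x y z) = G l x y z := fun l x y z => by rw [← hG]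
    simp only [hG'] at hex ⊢
    have h := integral_signed_sum q ![1, 1, 1, -1, 1, -1, -1, -1]
      ![fun l => G l a b c, fun l => G l a b' c, fun l => G l a b c', fun l => G l a b' c',
        fun l => G l a' b c, fun l => G l a' b' c, fun l => G l a' b c', fun l => G l a' b' c']
      (by intro i; fin_cases i <;> exact (hex _ _ _).1)
    symm
    simpa [Fin.sum_univ_eight, svetlichnySum, sub_eq_add_neg] using h.2
  rw [hsv, ← Real.norm_eq_abs]
  exact norm_integral_le_of_norm_le_const (Filter.Eventually.of_forall h)

lemma integrable_mul_of_abs_le_one {Λ : Type} [MeasurableSpace Λ] {q : Measure Λ}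
    [IsFiniteMeasure q] {f g : Λ → ℝ} (hf : Measurable f) (hg : Measurable g)
    (hf1 : ∀ l, |f l| ≤ 1) (hg1 : ∀ l, |g l| ≤ 1) : Integrable (fun l => f l * g l) q := by
  refine Integrable.of_bound (hf.mul hg).aestronglyMeasurable 1 (Filter.Eventually.of_forall ?_)
  intro l
  rw [Real.norm_eq_abs, abs_mul]
  exact mul_le_one₀ (hf1 l) (abs_nonneg _) (hg1 l)

lemma AdmitsBiLHV.abs_svetlichnySum_le {ρ : Op3} (h : AdmitsBiLHV ρ)
    (a a' b b' c c' : Direction) :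
    |svetlichnySum (fun x y z => expect3 (bornProb ρ x y z)) a a' b b' c c'| ≤ 4 := by
  obtain ⟨Λ, _, q₁, q₂, q₃, PAB, PAC, PBC, PA, PB, PC, hq, hAB, hAC, hBC, hA, hB, hC, hP⟩ := h
  have hle : q₁ Set.univ ≤ 1 ∧ q₂ Set.univ ≤ 1 ∧ q₃ Set.univ ≤ 1 := by
    rw [← hq]
    exact ⟨le_self_add.trans le_self_add, le_add_self.trans le_self_add, le_add_self⟩
  have : IsFiniteMeasure q₁ := ⟨hle.1.trans_lt ENNReal.one_lt_top⟩
  have : IsFiniteMeasure q₂ := ⟨hle.2.1.trans_lt ENNReal.one_lt_top⟩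
  have : IsFiniteMeasure q₃ := ⟨hle.2.2.trans_lt ENNReal.one_lt_top⟩
  have hreal : q₁.real Set.univ + q₂.real Set.univ + q₃.real Set.univ = 1 := by
    rw [measureReal_def, measureReal_def, measureReal_def, ← ENNReal.toReal_add, ← ENNReal.toReal_add,
      hq, ENNReal.toReal_one]
    all_goals finiteness
  have h1 := abs_svetlichnySum_integral_le q₁
    (fun l x y z a b c => PAB l x y (a, b) * PC l z c)
    (fun x y z a b c => integrable_mul_of_abs_le_one (hAB.2 _ _ _) (hC.2 _ _)
      (fun l => (hAB.1 l _ _).abs_apply_le _) (fun l => (hC.1 l _).abs_apply_le _))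
    a a' b b' c c' (by
      intro l
      have e := fun x y => abs_le_one_of_isProbDist_prod (hAB.1 l x y)
      have f := fun z => abs_le_one_of_isProbDist (hC.1 l z)
      refine le_trans (le_of_eq ?_)
        (abs_bilocal_le (e a b) (e a b') (e a' b) (e a' b') (f c) (f c'))
      simp only [svetlichnySum, expect3]
      congr 1
      ring)
  have h2 := abs_svetlichnySum_integral_le q₂
    (fun l x y z a b c => PAC l x z (a, c) * PB l y b)
    (fun x y z a b c => integrable_mul_of_abs_le_one (hAC.2 _ _ _) (hB.2 _ _)
      (fun l => (hAC.1 l _ _).abs_apply_le _) (fun l => (hB.1 l _).abs_apply_le _))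
    a a' b b' c c' (by
      intro l
      have e := fun x y => abs_le_one_of_isProbDist_prod (hAC.1 l x y)
      have f := fun z => abs_le_one_of_isProbDist (hB.1 l z)
      refine le_trans (le_of_eq ?_)
        (abs_bilocal_le (e a c) (e a c') (e a' c) (e a' c') (f b) (f b'))
      simp only [svetlichnySum, expect3]
      congr 1
      ring)
  have h3 := abs_svetlichnySum_integral_le q₃
    (fun l x y z a b c => PBC l y z (b, c) * PA l x a)
    (fun x y z a b c => integrable_mul_of_abs_le_one (hBC.2 _ _ _) (hA.2 _ _)
      (fun l => (hBC.1 l _ _).abs_apply_le _) (fun l => (hA.1 l _).abs_apply_le _))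
    a a' b b' c c' (by
      intro l
      have e := fun x y => abs_le_one_of_isProbDist_prod (hBC.1 l x y)
      have f := fun z => abs_le_one_of_isProbDist (hA.1 l z)
      refine le_trans (le_of_eq ?_)
        (abs_bilocal_le (e b c) (e b' c) (e b c') (e b' c') (f a) (f a'))
      simp only [svetlichnySum, expect3]
      congr 1
      ring)
  have hsum : ∀ E₁ E₂ E₃ : Direction → Direction → Direction → ℝ,
      svetlichnySum (fun x y z => E₁ x y z + E₂ x y z + E₃ x y z) a a' b b' c c' =
        svetlichnySum E₁ a a' b b' c c' + svetlichnySum E₂ a a' b b' c c' +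
          svetlichnySum E₃ a a' b b' c c' := by
    intro E₁ E₂ E₃
    simp only [svetlichnySum]
    ring
  have hexp : ∀ F₁ F₂ F₃ : ℤˣ → ℤˣ → ℤˣ → ℝ,
      expect3 (fun i j k => F₁ i j k + F₂ i j k + F₃ i j k) =
        expect3 F₁ + expect3 F₂ + expect3 F₃ := by
    intro F₁ F₂ F₃
    simp only [expect3]
    ring
  have key : ∀ x y z, expect3 (bornProb ρ x y z) =
      expect3 (fun i j k => ∫ l, PAB l x y (i, j) * PC l z k ∂q₁) +
      expect3 (fun i j k => ∫ l, PAC l x z (i, k) * PB l y j ∂q₂) +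
      expect3 (fun i j k => ∫ l, PBC l y z (j, k) * PA l x i ∂q₃) := by
    intro x y z
    rw [← hexp]
    congr 1
    funext i j k
    exact hP x y z i j k
  simp only [key, hsum]
  refine (abs_add_three _ _ _).trans ?_
  linarith

/-- The correlators are assumed to be real because the Svetlichny inequality concerns the modulus of a
complex trace, of which a model for the probabilities controls the real part only. -/
lemma genuinelyNonlocal_of_violates {ρ : Op3} {P Q : ℝ}
    (hE : ∀ x y z, Matrix.trace (tensor (obs x) (obs y) (obs z) * ρ) = (corr P Q x y z : ℂ))
    (h : ViolatesSvetlichny ρ) : GenuinelyNonlocal ρ := by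
  intro hL
  obtain ⟨v, ⟨a, a', b, b', c, c', rfl⟩, hv⟩ := h
  rw [trace_svetlichny_mul ρ _ hE, Complex.norm_real, Real.norm_eq_abs] at hv
  have := hL.abs_svetlichnySum_le a a' b b' c c'
  simp only [expect3_bornProb, hE, Complex.ofReal_re] at this
  exact absurd this (not_le.mpr hv)

/-! ### Maximal values before and after filtering -/

lemma cos_pi_div_eight_sq : Real.cos (Real.pi / 8) ^ 2 = (2 + √2) / 4 := by
  rw [Real.cos_sq, show 2 * (Real.pi / 8) = Real.pi / 4 by ring, Real.cos_pi_div_four]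
  ring

lemma sin_pi_div_eight_sq : Real.sin (Real.pi / 8) ^ 2 = (2 - √2) / 4 := by
  rw [Real.sin_sq, cos_pi_div_eight_sq]
  ring

lemma cos_mul_sin_pi_div_eight : Real.cos (Real.pi / 8) * Real.sin (Real.pi / 8) = √2 / 4 := by
  have := Real.sin_two_mul (Real.pi / 8)
  rw [show 2 * (Real.pi / 8) = Real.pi / 4 by ring, Real.sin_pi_div_four] at this
  linarith

lemma isGreatest_svetlichnyValues_rhoChi {p : ℝ} (hp : 0 ≤ p) :
    IsGreatest (svetlichnyValues (rhoChi p (Real.pi / 8))) (4 * p) := by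
  have h2 : √2 ^ 2 = (2 : ℝ) := Real.sq_sqrt (by norm_num)
  have hE : ∀ x y z, Matrix.trace (tensor (obs x) (obs y) (obs z) * rhoChi p (Real.pi / 8)) =
      (corr (p * (√2 / 2)) (p * (√2 / 2)) x y z : ℂ) := by
    intro x y z
    rw [rhoChi_eq_coreOp, trace_obs_mul_coreOp, cos_pi_div_eight_sq, sin_pi_div_eight_sq,
      cos_mul_sin_pi_div_eight]
    congr 2 <;> ring
  constructor
  · obtain ⟨a, a', b, b', c, c', h⟩ := exists_svetlichnySum_corr_eq (p * (√2 / 2)) (p * (√2 / 2))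
    refine ⟨a, a', b, b', c, c', ?_⟩
    rw [trace_svetlichny_mul _ _ hE, h, Complex.norm_real, Real.norm_eq_abs,
      show 4 * (√2 * (p * (√2 / 2))) = 4 * p by linear_combination 2 * p * h2,
      abs_of_nonneg (by positivity)]
  · rintro v ⟨a, a', b, b', c, c', rfl⟩
    rw [trace_svetlichny_mul _ _ hE, Complex.norm_real, Real.norm_eq_abs,
      show svetlichnySum (corr (p * (√2 / 2)) (p * (√2 / 2))) a a' b b' c c' =
        p * svetlichnySum (corr (√2 / 2) (√2 / 2)) a a' b b' c c' by
          simp only [svetlichnySum, corr]; ring, abs_mul, abs_of_nonneg hp]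
    have := abs_svetlichnySum_corr_le (P := √2 / 2) (Q := √2 / 2) (by linarith) (by linarith)
      a a' b b' c c'
    nlinarith

lemma posSemidef_diagFilter {t : ℝ} (ht : 0 ≤ t) : (diagFilter t).PosSemidef := by
  have : diagFilter t = Matrix.diagonal ![(t : ℂ), 1] := by
    ext i j
    fin_cases i <;> fin_cases j <;> simp [diagFilter]
  rw [this]
  refine Matrix.PosSemidef.diagonal ?_
  intro i
  fin_cases i <;> simp [ht]

/-- The normalization factor of `ρ_χ(p,π/8)` filtered by `diag(x,1) ⊗ diag(y,1) ⊗ diag(z,1)`. -/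
noncomputable def diagNorm (p x y z : ℝ) : ℝ :=
  p * ((2 + √2) / 4 * (x * y * z) ^ 2 + (2 - √2) / 4) +
    (1 - p) / 2 * (x ^ 2 * y ^ 2 * z ^ 2 + x ^ 2 * y ^ 2)

lemma filterNorm_rhoChi (p x y z : ℝ) :
    filterNorm (diagFilter x) (diagFilter y) (diagFilter z) (rhoChi p (Real.pi / 8)) =
      (diagNorm p x y z : ℂ) := by
  rw [rhoChi_eq_coreOp, filterNorm_coreOp, mul_pow, cos_pi_div_eight_sq, sin_pi_div_eight_sq,
    diagNorm]
  congr 1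
  ring

lemma sqrt_two_lt_two : √2 < (2 : ℝ) := by
  rw [Real.sqrt_lt' (by norm_num)]
  norm_num

lemma diagNorm_nonneg {p x y z : ℝ} (hp : 0 ≤ p) (hp1 : p ≤ 1) : 0 ≤ diagNorm p x y z := by
  have := sqrt_two_lt_two
  have h1 : 0 ≤ (2 - √2) / 4 := by linarith
  have h2 : 0 ≤ 1 - p := by linarith
  unfold diagNorm
  positivity

lemma trace_obs_mul_filtered (p a b c : ℝ) (x y z : Direction) :
    Matrix.trace (tensor (obs x) (obs y) (obs z) *
        filtered (diagFilter a) (diagFilter b) (diagFilter c) (rhoChi p (Real.pi / 8))) =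
      (corr ((p * ((2 + √2) / 4 * (a * b * c) ^ 2 - (2 - √2) / 4) +
          (1 - p) / 2 * (a ^ 2 * b ^ 2 * c ^ 2 - a ^ 2 * b ^ 2)) / diagNorm p a b c)
        (p * (√2 / 2) * (a * b * c) / diagNorm p a b c) x y z : ℂ) := by
  have hN : diagNorm p a b c = p * ((a * b * c * Real.cos (Real.pi / 8)) ^ 2 +
      Real.sin (Real.pi / 8) ^ 2) + (a ^ 2 * b ^ 2 * c ^ 2 * ((1 - p) / 2) +
        a ^ 2 * b ^ 2 * ((1 - p) / 2)) := by
    rw [mul_pow, cos_pi_div_eight_sq, sin_pi_div_eight_sq, diagNorm]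
    ring
  rw [rhoChi_eq_coreOp, filtered_coreOp_corr, ← hN, mul_pow, cos_pi_div_eight_sq,
    sin_pi_div_eight_sq, cos_mul_sin_pi_div_eight]
  congr 3 <;> ring

/-- The filtered state violates the Svetlichny inequality iff its `xy`-plane correlations do:
those in the `z`-direction never exceed the normalization. -/
lemma violatesSvetlichny_filtered_iff {p x y z : ℝ} (hp : 0 ≤ p) (hp1 : p ≤ 1) (hx : 0 ≤ x)
    (hy : 0 ≤ y) (hz : 0 ≤ z) (hN : 0 < diagNorm p x y z) :
    ViolatesSvetlichny
        (filtered (diagFilter x) (diagFilter y) (diagFilter z) (rhoChi p (Real.pi / 8))) ↔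
      diagNorm p x y z < p * (x * y * z) := by
  have h2 : √2 ^ 2 = (2 : ℝ) := Real.sq_sqrt (by norm_num)
  have hE := trace_obs_mul_filtered p x y z
  constructor
  · rintro ⟨v, ⟨a, a', b, b', c, c', rfl⟩, hv⟩
    by_contra hcon
    rw [not_lt] at hcon
    rw [trace_svetlichny_mul _ _ hE, Complex.norm_real, Real.norm_eq_abs] at hv
    refine absurd (abs_svetlichnySum_corr_le ?_ ?_ a a' b b' c c') (not_le.mpr hv)
    · rw [sq_le_one_iff_abs_le_one, abs_div, abs_of_pos hN, div_le_one hN, abs_le]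
      have h1 : 0 ≤ p * ((2 - √2) / 4) := mul_nonneg hp (by linarith [sqrt_two_lt_two])
      have h3 : 0 ≤ p * ((2 + √2) / 4 * (x * y * z) ^ 2) := by positivity
      have h4 : 0 ≤ (1 - p) / 2 * (x ^ 2 * y ^ 2 * z ^ 2) :=
        mul_nonneg (by linarith) (by positivity)
      have h5 : 0 ≤ (1 - p) / 2 * (x ^ 2 * y ^ 2) := mul_nonneg (by linarith) (by positivity)
      unfold diagNorm
      constructor <;> linarith
    · have h3 : 2 * (p * (√2 / 2) * (x * y * z) / diagNorm p x y z) ^ 2 =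
          (p * (x * y * z) / diagNorm p x y z) ^ 2 := by
        rw [div_pow, div_pow, mul_pow, mul_pow p (√2 / 2), div_pow, h2]
        ring
      rw [h3]
      have h4 : 0 ≤ p * (x * y * z) / diagNorm p x y z := by positivity
      exact pow_le_one₀ h4 ((div_le_one hN).mpr hcon)
  · intro h
    obtain ⟨a, a', b, b', c, c', hS⟩ := exists_svetlichnySum_corr_eq
      ((p * ((2 + √2) / 4 * (x * y * z) ^ 2 - (2 - √2) / 4) +
          (1 - p) / 2 * (x ^ 2 * y ^ 2 * z ^ 2 - x ^ 2 * y ^ 2)) / diagNorm p x y z)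
      (p * (√2 / 2) * (x * y * z) / diagNorm p x y z)
    refine ⟨_, ⟨a, a', b, b', c, c', rfl⟩, ?_⟩
    rw [trace_svetlichny_mul _ _ hE, hS, Complex.norm_real, Real.norm_eq_abs]
    refine lt_of_lt_of_le ?_ (le_abs_self _)
    have : √2 * (p * (√2 / 2) * (x * y * z) / diagNorm p x y z) =
        p * (x * y * z) / diagNorm p x y z := by
      linear_combination (p * (x * y * z) / diagNorm p x y z / 2) * h2
    rw [this]
    have := (one_lt_div hN).mpr h
    linarith

/-- With `m = xyz` and `w = xy`, a violation needs `p m > A m² + p s² + (1-p) w²/2`, where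
`A = p c² + (1-p)/2`, `c = cos π/8`, `s = sin π/8`; for `w → 0` this is solvable in `m` iff
`p > 4 A s²`. -/
lemma threshold_iff (p : ℝ) :
    (4 - √2) / 7 < p ↔ 4 * (p * ((2 + √2) / 4) + (1 - p) / 2) * ((2 - √2) / 4) < p := by
  have h2 : √2 ^ 2 = (2 : ℝ) := Real.sq_sqrt (by norm_num)
  have h3 : 0 < 3 - √2 := by linarith [sqrt_two_lt_two]
  have h4 : 4 * (p * ((2 + √2) / 4) + (1 - p) / 2) * ((2 - √2) / 4) - p =
      (3 - √2) / 2 * ((4 - √2) / 7 - p) := by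
    linear_combination (-p / 4 - 1 / 14) * h2
  rw [← sub_neg, ← sub_neg (b := p) (a := _ * _), h4]
  constructor
  · intro h
    exact mul_neg_of_pos_of_neg (by linarith) h
  · intro h
    exact neg_of_mul_neg_right h (by linarith)

lemma exists_diagFilter_iff {p : ℝ} (hp : 0 ≤ p) (hp1 : p ≤ 1) :
    (∃ x y z : ℝ, 0 ≤ x ∧ 0 ≤ y ∧ 0 ≤ z ∧
        IsLocalFilter (diagFilter x) (diagFilter y) (diagFilter z) (rhoChi p (Real.pi / 8)) ∧
        ViolatesSvetlichny
          (filtered (diagFilter x) (diagFilter y) (diagFilter z) (rhoChi p (Real.pi / 8)))) ↔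
      (4 - √2) / 7 < p := by
  have hs : 0 < (2 - √2) / 4 := by linarith [sqrt_two_lt_two]
  rw [threshold_iff]
  set A := p * ((2 + √2) / 4) + (1 - p) / 2 with hA
  set s := (2 - √2) / 4 with hs_def
  have hNA : ∀ x y z, diagNorm p x y z =
      A * (x * y * z) ^ 2 + p * s + (1 - p) / 2 * (x * y) ^ 2 := by
    intro x y z
    rw [diagNorm, hA]
    ring
  have hA0 : 0 < A := by
    rw [hA]
    have : 0 ≤ p * √2 := by positivity
    linarith
  constructor
  · rintro ⟨x, y, z, hx, hy, hz, ⟨-, -, -, hN0⟩, hv⟩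
    rw [filterNorm_rhoChi, Complex.ofReal_ne_zero] at hN0
    have hN : 0 < diagNorm p x y z := lt_of_le_of_ne (diagNorm_nonneg hp hp1) hN0.symm
    rw [violatesSvetlichny_filtered_iff hp hp1 hx hy hz hN, hNA] at hv
    generalize x * y * z = m at hv
    have hw : 0 ≤ (1 - p) / 2 * (x * y) ^ 2 := mul_nonneg (by linarith) (sq_nonneg _)
    -- Completing the square in `m` turns the violation into positivity of the discriminant.
    have hp0 : 0 < p := by
      rcases hp.eq_or_lt with h | h
      · have := mul_nonneg hA0.le (sq_nonneg m)
        rw [← h] at hv hw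
        linarith
      · exact h
    have h1 : 4 * A * (p * s) < p * p := by
      have := mul_lt_mul_of_pos_left (show A * m ^ 2 + p * s < p * m by linarith)
        (show 0 < 4 * A by linarith)
      linarith [sq_nonneg (2 * A * m - p)]
    exact lt_of_mul_lt_mul_left (by linarith : p * (4 * A * s) < p * p) hp
  · intro h
    have hp0 : 0 < p := lt_trans (by positivity) h
    -- `m = p / (2A)` maximizes `p m - A m² - p s²`, with maximum `g`; then `w² = g` leaves a margin.
    set g := p * (p - 4 * A * s) / (4 * A) with hg
    have hg0 : 0 < g := div_pos (mul_pos hp0 (by linarith)) (by linarith)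
    have hw0 : 0 < √g := Real.sqrt_pos.mpr hg0
    have hm : √g * 1 * (p / (2 * A) / √g) = p / (2 * A) := by
      field_simp
    have hN : 0 < diagNorm p (√g) 1 (p / (2 * A) / √g) := by
      rw [hNA]
      have := mul_pos hp0 hs
      have := mul_nonneg (show 0 ≤ (1 - p) / 2 by linarith) (sq_nonneg (√g * 1))
      positivity
    have hz : 0 ≤ p / (2 * A) / √g := by positivity
    refine ⟨√g, 1, p / (2 * A) / √g, hw0.le, zero_le_one, hz,
      ⟨posSemidef_diagFilter hw0.le, posSemidef_diagFilter zero_le_one, posSemidef_diagFilter hz, ?_⟩,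
      ?_⟩
    · rw [filterNorm_rhoChi, Complex.ofReal_ne_zero]
      exact hN.ne'
    · rw [violatesSvetlichny_filtered_iff hp hp1 hw0.le zero_le_one hz hN, hNA, hm, mul_one,
        Real.sq_sqrt hg0.le]
      have h1 : p * (p / (2 * A)) - A * (p / (2 * A)) ^ 2 - p * s = g := by
        rw [hg]
        field_simp
        ring
      nlinarith

/-! ### The uniform distribution of directions -/

/-- Three-dimensional real Euclidean space, home of Bloch vectors. -/
abbrev Vec3 : Type := EuclideanSpace ℝ (Fin 3)

/-- The uniform probability measure on the unit ball. Only the direction `unitDir l` of its points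
matters, which is uniformly distributed on the unit sphere. -/
noncomputable def ballMeasure : Measure Vec3 :=
  ProbabilityTheory.cond volume (Metric.ball (0 : Vec3) 1)

instance : IsProbabilityMeasure ballMeasure :=
  ProbabilityTheory.cond_isProbabilityMeasure_of_finite
    (Metric.measure_ball_pos volume _ one_pos).ne' measure_ball_lt_top.ne

/-- The direction of a vector (`0` for the vector `0`). -/
noncomputable def unitDir (l : Vec3) : Vec3 := ‖l‖⁻¹ • l

lemma norm_unitDir_le (l : Vec3) : ‖unitDir l‖ ≤ 1 := by
  rw [unitDir, norm_smul, norm_inv, norm_norm]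
  exact inv_mul_le_one

lemma abs_inner_unitDir_le (v l : Vec3) : |inner ℝ v (unitDir l)| ≤ ‖v‖ :=
  (abs_real_inner_le_norm _ _).trans (mul_le_of_le_one_right (norm_nonneg _) (norm_unitDir_le l))

lemma norm_unitDir_ae : ∀ᵐ l ∂ballMeasure, ‖unitDir l‖ = 1 := by
  have h : ∀ᵐ l ∂ballMeasure, l ≠ 0 := by
    have hac : ballMeasure ≪ volume := ProbabilityTheory.cond_absolutelyContinuous
    refine hac.ae_le (?_ : ∀ᵐ l : Vec3 ∂volume, l ≠ 0)
    simp [ae_iff]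
  filter_upwards [h] with l hl
  rw [unitDir, norm_smul, norm_inv, norm_norm, inv_mul_cancel₀ (norm_ne_zero_iff.mpr hl)]

@[fun_prop]
lemma measurable_unitDir : Measurable unitDir := by
  unfold unitDir
  fun_prop

lemma unitDir_map (R : Vec3 ≃ₗᵢ[ℝ] Vec3) (l : Vec3) : unitDir (R l) = R (unitDir l) := by
  simp [unitDir]

lemma measurePreserving_ballMeasure (R : Vec3 ≃ₗᵢ[ℝ] Vec3) :
    MeasurePreserving R ballMeasure ballMeasure := by
  have h := R.measurePreserving.restrict_preimage (s := Metric.ball (0 : Vec3) 1)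
    measurableSet_ball
  rw [R.preimage_ball, map_zero] at h
  exact ⟨h.measurable, by
    unfold ballMeasure ProbabilityTheory.cond
    rw [Measure.map_smul, h.map_eq]⟩

lemma integral_unitDir_map (R : Vec3 ≃ₗᵢ[ℝ] Vec3) (f : Vec3 → ℝ) :
    ∫ l, f (R (unitDir l)) ∂ballMeasure = ∫ l, f (unitDir l) ∂ballMeasure := by
  simp only [← unitDir_map]
  exact (measurePreserving_ballMeasure R).integral_comp
    R.toHomeomorph.measurableEmbedding (fun l => f (unitDir l))

lemma integral_unitDir_odd {f : Vec3 → ℝ} (hf : ∀ w, f (-w) = -f w) :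
    ∫ l, f (unitDir l) ∂ballMeasure = 0 := by
  have h := integral_unitDir_map (LinearIsometryEquiv.neg ℝ) f
  simp only [LinearIsometryEquiv.coe_neg, hf, integral_neg] at h
  linarith

/-- The mean of `|⟨e, λ⟩|` over uniformly distributed directions `λ`, for a unit vector `e`. -/
noncomputable def meanAbs : ℝ :=
  ∫ l, |inner ℝ (EuclideanSpace.single (2 : Fin 3) (1 : ℝ)) (unitDir l)| ∂ballMeasure

lemma integral_abs_inner_of_norm_eq_one {e : Vec3} (he : ‖e‖ = 1) :
    ∫ l, |inner ℝ e (unitDir l)| ∂ballMeasure = meanAbs := by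
  set R := (ℝ ∙ (e - EuclideanSpace.single (2 : Fin 3) (1 : ℝ)))ᗮ.reflection
  have hR : R e = EuclideanSpace.single (2 : Fin 3) (1 : ℝ) :=
    Submodule.reflection_sub (by simp [he])
  rw [meanAbs, ← hR, ← integral_unitDir_map R fun l => |inner ℝ (R e) l|]
  simp only [LinearIsometryEquiv.inner_map_map]

lemma integral_abs_inner (v : Vec3) :
    ∫ l, |inner ℝ v (unitDir l)| ∂ballMeasure = meanAbs * ‖v‖ := by
  rcases eq_or_ne v 0 with rfl | hv
  · simp
  · have he : ‖‖v‖⁻¹ • v‖ = 1 := by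
      rw [norm_smul, norm_inv, norm_norm, inv_mul_cancel₀ (norm_ne_zero_iff.mpr hv)]
    have hv' : 0 < ‖v‖ := norm_pos_iff.mpr hv
    have h := integral_abs_inner_of_norm_eq_one he
    simp only [real_inner_smul_left, abs_mul, abs_inv, abs_norm, integral_const_mul] at h
    rw [← h]
    field_simp

lemma measurable_real_sign : Measurable Real.sign := by
  unfold Real.sign
  exact Measurable.ite measurableSet_Iio measurable_const
    (Measurable.ite measurableSet_Ioi measurable_const measurable_const)

lemma mul_real_sign_self (t : ℝ) : t * Real.sign t = |t| := by
  rcases lt_trichotomy t 0 with h | h | h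
  · rw [Real.sign_of_neg h, abs_of_neg h, mul_neg_one]
  · simp [h]
  · rw [Real.sign_of_pos h, abs_of_pos h, mul_one]

lemma abs_real_sign_le (t : ℝ) : |Real.sign t| ≤ 1 := by
  rcases Real.sign_apply_eq t with h | h | h <;> simp [h]

lemma integrable_of_bounded {f : Vec3 → ℝ} (hf : Measurable f) {C : ℝ} (hC : ∀ l, |f l| ≤ C) :
    Integrable f ballMeasure :=
  Integrable.of_bound hf.aestronglyMeasurable C (Filter.Eventually.of_forall hC)

lemma integrable_inner (v : Vec3) : Integrable (fun l => inner ℝ v (unitDir l)) ballMeasure :=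
  integrable_of_bounded (by fun_prop) (abs_inner_unitDir_le v)

/-- `⟨v, λ⟩` correlates with the sign of `⟨z, λ⟩` through the component of `v` along `z` only: the
reflection in the plane orthogonal to the rest of `v` preserves the distribution. -/
lemma integral_inner_mul_sign (v : Vec3) {z : Vec3} (hz : ‖z‖ = 1) :
    ∫ l, inner ℝ v (unitDir l) * Real.sign (inner ℝ z (unitDir l))
      ∂ballMeasure = meanAbs * inner ℝ v z := by
  set w := v - inner ℝ v z • z with hw
  have hwz : inner ℝ z w = 0 := by
    rw [hw, inner_sub_right, real_inner_smul_right, real_inner_self_eq_norm_sq, hz,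
      real_inner_comm]
    ring
  have hmeas : Measurable fun l : Vec3 => Real.sign (inner ℝ z (unitDir l)) :=
    measurable_real_sign.comp (by fun_prop)
  have hint : ∀ y : Vec3, Integrable (fun l => inner ℝ y (unitDir l) *
      Real.sign (inner ℝ z (unitDir l))) ballMeasure := by
    intro y
    refine integrable_of_bounded ((by fun_prop : Measurable _).mul hmeas) (C := ‖y‖) fun l => ?_
    rw [abs_mul]
    refine (mul_le_of_le_one_right (abs_nonneg _) (abs_real_sign_le _)).trans
      (abs_inner_unitDir_le y l)
  have hw0 : ∫ l, inner ℝ w (unitDir l) * Real.sign (inner ℝ z (unitDir l))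
      ∂ballMeasure = 0 := by
    set R := (ℝ ∙ w)ᗮ.reflection with hR
    have hRw : R w = -w := Submodule.reflection_orthogonalComplement_singleton_eq_neg w
    have hRz : R z = z := by
      refine Submodule.reflection_mem_subspace_eq_self ?_
      rw [Submodule.mem_orthogonal_singleton_iff_inner_left]
      exact hwz
    have h := integral_unitDir_map R (fun l => inner ℝ w l *
      Real.sign (inner ℝ z l))
    have h1 : ∀ l, inner ℝ w (R l) = -inner ℝ w l := fun l => by
      rw [← R.inner_map_map, hRw, Submodule.reflection_reflection, inner_neg_left]
    have h2 : ∀ l, inner ℝ z (R l) = inner ℝ z l := fun l => by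
      conv_lhs => rw [← hRz]
      exact R.inner_map_map _ _
    simp only [h1, h2, neg_mul, integral_neg] at h
    linarith
  have hv : v = w + inner ℝ v z • z := by simp [hw]
  have hz1 := integral_abs_inner z
  rw [hz, mul_one] at hz1
  calc _ = ∫ l, (inner ℝ w (unitDir l) * Real.sign (inner ℝ z (unitDir l)) +
        inner ℝ v z * (inner ℝ z (unitDir l) *
          Real.sign (inner ℝ z (unitDir l)))) ∂ballMeasure := by
        congr 1
        funext l
        conv_lhs => rw [hv]
        rw [inner_add_left, real_inner_smul_left]
        ring
    _ = inner ℝ v z * ∫ l, |inner ℝ z (unitDir l)| ∂ballMeasure := by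
        rw [integral_add (hint w) ((hint z).const_mul _), hw0, zero_add, integral_const_mul]
        simp only [mul_real_sign_self]
    _ = _ := by rw [hz1, mul_comm]

/-- The pointwise bound `|t| ≥ 2t² - (32/27) t⁴`, tangent at `|t| = 3/4`. -/
lemma two_mul_sq_sub_le_abs (t : ℝ) : 2 * t ^ 2 - 32 / 27 * t ^ 4 ≤ |t| := by
  have h : |t| - (2 * |t| ^ 2 - 32 / 27 * |t| ^ 4) =
      32 / 27 * |t| * (|t| - 3 / 4) ^ 2 * (|t| + 3 / 2) := by ring
  have h1 : |t| ^ 4 = t ^ 4 := Even.pow_abs (by decide) t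
  rw [sq_abs, h1] at h
  have : 0 ≤ 32 / 27 * |t| * (|t| - 3 / 4) ^ 2 * (|t| + 3 / 2) := by positivity
  linarith

/-- The exact value of `meanAbs` is `1/2`. This lower bound averages the bound
`two_mul_sq_sub_le_abs` over the nine axes `eᵢ` and `(eᵢ ± eⱼ)/√2`, with weights that make the averages
of `t²` and `t⁴` constant on the sphere, equal to `1/3` and `1/5`. -/
lemma le_meanAbs : 58 / 135 ≤ meanAbs := by
  set b : Fin 3 → Vec3 := fun i => EuclideanSpace.single i 1 with hb
  have h2 : √2 ^ 2 = (2 : ℝ) := Real.sq_sqrt (by norm_num)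
  have h0 : √2 ≠ 0 := by positivity
  have hbi : ∀ i l, inner ℝ (b i) l = l i := fun i l => by
    simp [hb, EuclideanSpace.inner_single_left]
  set e : Fin 9 → Vec3 := ![b 0, b 1, b 2, (√2)⁻¹ • (b 0 + b 1), (√2)⁻¹ • (b 0 - b 1),
    (√2)⁻¹ • (b 0 + b 2), (√2)⁻¹ • (b 0 - b 2), (√2)⁻¹ • (b 1 + b 2), (√2)⁻¹ • (b 1 - b 2)]
  set w : Fin 9 → ℝ := ![1 / 15, 1 / 15, 1 / 15, 2 / 15, 2 / 15, 2 / 15, 2 / 15, 2 / 15, 2 / 15]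
  have he : ∀ i, ‖e i‖ = 1 := by
    intro i
    fin_cases i <;>
      simp [e, hb, EuclideanSpace.norm_eq, Fin.sum_univ_three, norm_smul] <;>
      norm_num [abs_of_nonneg, h0]
  have hw : ∀ i, 0 ≤ w i := by
    intro i
    fin_cases i <;> norm_num [w]
  have hw1 : ∑ i, w i = 1 := by
    simp only [w, Fin.sum_univ_succ]
    simp
    norm_num
  have hsum : ∫ l, ∑ i, w i * |inner ℝ (e i) (unitDir l)| ∂ballMeasure = meanAbs := by
    rw [integral_finsetSum _ fun i _ => (integrable_inner _).abs.const_mul _]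
    simp only [integral_const_mul, integral_abs_inner_of_norm_eq_one (he _)]
    rw [← Finset.sum_mul, hw1, one_mul]
  rw [← hsum]
  have hconst : ∫ _ : Vec3, (58 / 135 : ℝ) ∂ballMeasure = 58 / 135 := by simp
  rw [← hconst]
  refine integral_mono_ae (integrable_const _)
    (integrable_finsetSum _ fun i _ => (integrable_inner _).abs.const_mul _) ?_
  filter_upwards [norm_unitDir_ae] with l hl
  have hl2 : unitDir l 0 ^ 2 + unitDir l 1 ^ 2 + unitDir l 2 ^ 2 = 1 := by
    have := EuclideanSpace.norm_sq_eq (unitDir l)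
    rw [hl, Fin.sum_univ_three] at this
    simpa using this.symm
  refine le_trans (le_of_eq ?_) (Finset.sum_le_sum fun i _ =>
    mul_le_mul_of_nonneg_left (two_mul_sq_sub_le_abs (inner ℝ (e i) (unitDir l))) (hw i))
  have hi : (√2)⁻¹ ^ 2 = (1 / 2 : ℝ) := by rw [inv_pow, h2]; norm_num
  have hi4 : (√2)⁻¹ ^ 4 = (1 / 4 : ℝ) := by
    rw [show (√2)⁻¹ ^ 4 = ((√2)⁻¹ ^ 2) ^ 2 by ring, hi]; norm_num
  simp [w, e, Fin.sum_univ_succ, real_inner_smul_left, inner_add_left, inner_sub_left, hbi]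
  generalize (√2)⁻¹ = s at *
  generalize unitDir l 0 = x at *
  generalize unitDir l 1 = y at *
  generalize unitDir l 2 = z at *
  ring_nf
  simp only [hi, hi4]
  linear_combination (-(2 / 3) + 32 / 135 * (x ^ 2 + y ^ 2 + z ^ 2 + 1)) * hl2

/-! ### A bi-local model -/

/-- The weight of `|00⟩` in the joint effect of the outcomes `ab.1`, `ab.2` on the qubits `A`, `B`. -/
noncomputable def zeroWeight (x y : Direction) (ab : ℤˣ × ℤˣ) : ℝ :=
  (1 + ((ab.1 : ℤ) : ℝ) * x.1 2) * (1 + ((ab.2 : ℤ) : ℝ) * y.1 2) / 4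

/-- The weight of `|11⟩` in the joint effect of the outcomes `ab.1`, `ab.2` on the qubits `A`, `B`. -/
noncomputable def oneWeight (x y : Direction) (ab : ℤˣ × ℤˣ) : ℝ :=
  (1 - ((ab.1 : ℤ) : ℝ) * x.1 2) * (1 - ((ab.2 : ℤ) : ℝ) * y.1 2) / 4

/-- The Bloch vector of the unnormalized state of qubit `C` left by the outcomes `ab` on `A`, `B` in
the vector `u|000⟩ + v|111⟩`. -/
noncomputable def steeredVec (u v : ℝ) (x y : Direction) (ab : ℤˣ × ℤˣ) : Vec3 :=
  !₂[((ab.1 : ℤ) : ℝ) * ((ab.2 : ℤ) : ℝ) * (u * v) * (x.1 0 * y.1 0 - x.1 1 * y.1 1) / 2,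
    -(((ab.1 : ℤ) : ℝ) * ((ab.2 : ℤ) : ℝ) * (u * v) * (x.1 0 * y.1 1 + x.1 1 * y.1 0) / 2),
    u ^ 2 * zeroWeight x y ab - v ^ 2 * oneWeight x y ab]

lemma intUnits_sq (a : ℤˣ) : ((a : ℤ) : ℝ) ^ 2 = 1 := by
  rcases Int.units_eq_one_or a with rfl | rfl <;> simp

lemma Direction.abs_coord_two_le (x : Direction) : |x.1 2| ≤ 1 := by
  rw [← sq_le_one_iff_abs_le_one]
  nlinarith [x.sum_sq, sq_nonneg (x.1 0), sq_nonneg (x.1 1)]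

lemma one_add_intUnits_mul_nonneg (a : ℤˣ) (x : Direction) : 0 ≤ 1 + ((a : ℤ) : ℝ) * x.1 2 := by
  have := abs_le.mp x.abs_coord_two_le
  rcases Int.units_eq_one_or a with rfl | rfl <;> simp <;> linarith

lemma zeroWeight_nonneg (x y : Direction) (ab : ℤˣ × ℤˣ) : 0 ≤ zeroWeight x y ab :=
  div_nonneg (mul_nonneg (one_add_intUnits_mul_nonneg _ _) (one_add_intUnits_mul_nonneg _ _))
    (by norm_num)

lemma oneWeight_nonneg (x y : Direction) (ab : ℤˣ × ℤˣ) : 0 ≤ oneWeight x y ab := by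
  have h := zeroWeight_nonneg x y (-ab.1, -ab.2)
  simpa [zeroWeight, oneWeight, sub_eq_add_neg] using h

lemma sum_pairs (f : ℤˣ × ℤˣ → ℝ) :
    ∑ ab, f ab = f (1, 1) + f (1, -1) + (f (-1, 1) + f (-1, -1)) := by
  rw [Fintype.sum_prod_type, sum_intUnits, sum_intUnits, sum_intUnits]

lemma sum_zeroWeight (x y : Direction) : ∑ ab, zeroWeight x y ab = 1 := by
  rw [sum_pairs]
  simp [zeroWeight]
  ring

lemma sum_oneWeight (x y : Direction) : ∑ ab, oneWeight x y ab = 1 := by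
  rw [sum_pairs]
  simp [oneWeight]
  ring

/-- The state left on qubit `C` is pure, because the effects on `A`, `B` have rank one. -/
lemma norm_steeredVec (u v : ℝ) (x y : Direction) (ab : ℤˣ × ℤˣ) :
    ‖steeredVec u v x y ab‖ = u ^ 2 * zeroWeight x y ab + v ^ 2 * oneWeight x y ab := by
  have h0 : 0 ≤ u ^ 2 * zeroWeight x y ab + v ^ 2 * oneWeight x y ab :=
    add_nonneg (mul_nonneg (sq_nonneg _) (zeroWeight_nonneg _ _ _))
      (mul_nonneg (sq_nonneg _) (oneWeight_nonneg _ _ _))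
  rw [← Real.sqrt_sq h0, EuclideanSpace.norm_eq, Fin.sum_univ_three]
  congr 1
  have hx := x.sum_sq
  have hy := y.sum_sq
  have ha := intUnits_sq ab.1
  have hb := intUnits_sq ab.2
  simp only [steeredVec, zeroWeight, oneWeight, Real.norm_eq_abs, sq_abs]
  simp
  generalize ((ab.1 : ℤ) : ℝ) = a at *
  generalize ((ab.2 : ℤ) : ℝ) = b at *
  generalize x.1 0 = x₁ at *
  generalize x.1 1 = x₂ at *
  generalize x.1 2 = x₃ at *
  generalize y.1 0 = y₁ at *
  generalize y.1 1 = y₂ at *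
  generalize y.1 2 = y₃ at *
  have hx' : x₁ ^ 2 + x₂ ^ 2 = 1 - x₃ ^ 2 := by linarith
  have hy' : y₁ ^ 2 + y₂ ^ 2 = 1 - y₃ ^ 2 := by linarith
  have h1 : (a * b * (u * v) * (x₁ * y₁ - x₂ * y₂) / 2) ^ 2 +
      (a * b * (u * v) * (x₁ * y₂ + x₂ * y₁) / 2) ^ 2 =
      a ^ 2 * b ^ 2 * (u * v) ^ 2 / 4 * ((x₁ ^ 2 + x₂ ^ 2) * (y₁ ^ 2 + y₂ ^ 2)) := by ring
  have h2 : (1 + a * x₃) * (1 - a * x₃) = 1 - x₃ ^ 2 := by linear_combination -x₃ ^ 2 * ha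
  have h3 : (1 + b * y₃) * (1 - b * y₃) = 1 - y₃ ^ 2 := by linear_combination -y₃ ^ 2 * hb
  rw [h1, ha, hb, hx', hy', ← h2, ← h3]
  ring

lemma sum_norm_steeredVec {u v : ℝ} (huv : u ^ 2 + v ^ 2 = 1) (x y : Direction) :
    ∑ ab, ‖steeredVec u v x y ab‖ = 1 := by
  simp only [norm_steeredVec, Finset.sum_add_distrib, ← Finset.mul_sum, sum_zeroWeight,
    sum_oneWeight]
  linarith

lemma sum_inner_steeredVec (u v : ℝ) (x y : Direction) (w : Vec3) :
    ∑ ab, inner ℝ (steeredVec u v x y ab) w = (u ^ 2 - v ^ 2) * w 2 := by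
  rw [sum_pairs]
  simp [steeredVec, PiLp.inner_apply, Fin.sum_univ_three, zeroWeight, oneWeight]
  ring

/-- The correlations of `ρ_χ(p,θ)`, with `u = cos θ` and `v = sin θ`. -/
lemma bornProb_coreOp (p u v : ℝ) (x y z : Direction) (a b c : ℤˣ) :
    bornProb (coreOp p u v ((1 - p) / 2) ((1 - p) / 2)) x y z a b c =
      (p * ‖steeredVec u v x y (a, b)‖ + (1 - p) * zeroWeight x y (a, b)) / 2 +
        ((c : ℤ) : ℝ) / 2 * (p * inner ℝ (steeredVec u v x y (a, b)) z.1) := by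
  have h : Matrix.trace (tensor (proj x a) (proj y b) (proj z c) *
      coreOp p u v ((1 - p) / 2) ((1 - p) / 2)) =
      (((p * (u ^ 2 * zeroWeight x y (a, b) + v ^ 2 * oneWeight x y (a, b)) +
        (1 - p) * zeroWeight x y (a, b)) / 2 +
        ((c : ℤ) : ℝ) / 2 * (p * inner ℝ (steeredVec u v x y (a, b)) z.1) : ℝ) : ℂ) := by
    rw [trace_tensor_mul_coreOp, proj_apply, proj_apply, proj_apply]
    simp [steeredVec, PiLp.inner_apply, Fin.sum_univ_three, zeroWeight, oneWeight]
    ring_nf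
    simp only [Complex.I_sq]
    ring
  rw [bornProb, Matrix.trace_mul_comm, h, Complex.ofReal_re, norm_steeredVec]

/-- The density of the hidden direction relative to the uniform distribution; its asymmetry along the
`z`-axis accounts for the bias of the outcomes of `C`. -/
noncomputable def hiddenDensity (r u v : ℝ) (l : Vec3) : ℝ := 1 + r * (u ^ 2 - v ^ 2) * unitDir l 2

/-- The joint density of the hidden direction and the outcomes `ab`. The first term reproduces the
correlations of the entangled state; the rest is assigned to the outcomes as in the state `|00⟩`. -/
noncomputable def jointDensity (r u v : ℝ) (l : Vec3) (x y : Direction) (ab : ℤˣ × ℤˣ) : ℝ :=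
  r * (|inner ℝ (steeredVec u v x y ab) (unitDir l)| + inner ℝ (steeredVec u v x y ab) (unitDir l)) +
    zeroWeight x y ab * (1 - r * ∑ ab', |inner ℝ (steeredVec u v x y ab') (unitDir l)|)

lemma jointDensity_nonneg {r u v : ℝ} (hr : 0 ≤ r) (hr1 : r ≤ 1) (huv : u ^ 2 + v ^ 2 = 1)
    (l : Vec3) (x y : Direction) (ab : ℤˣ × ℤˣ) : 0 ≤ jointDensity r u v l x y ab := by
  have h1 : ∑ ab', |inner ℝ (steeredVec u v x y ab') (unitDir l)| ≤ 1 := by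
    rw [← sum_norm_steeredVec huv x y]
    exact Finset.sum_le_sum fun ab' _ => abs_inner_unitDir_le _ l
  have h2 : r * ∑ ab', |inner ℝ (steeredVec u v x y ab') (unitDir l)| ≤ 1 :=
    mul_le_one₀ hr1 (Finset.sum_nonneg fun _ _ => abs_nonneg _) h1
  refine add_nonneg (mul_nonneg hr ?_)
    (mul_nonneg (zeroWeight_nonneg x y ab) (by linarith))
  linarith [neg_abs_le (inner ℝ (steeredVec u v x y ab) (unitDir l))]

lemma sum_jointDensity (r u v : ℝ) (l : Vec3) (x y : Direction) :
    ∑ ab, jointDensity r u v l x y ab = hiddenDensity r u v l := by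
  simp only [jointDensity, Finset.sum_add_distrib, ← Finset.mul_sum, ← Finset.sum_mul,
    sum_zeroWeight, sum_inner_steeredVec, hiddenDensity]
  ring

lemma hiddenDensity_pos {r u v : ℝ} (hr : 0 ≤ r) (hr1 : r ≤ 1) (huv : |u ^ 2 - v ^ 2| < 1)
    (l : Vec3) : 0 < hiddenDensity r u v l := by
  have h1 : |unitDir l 2| ≤ 1 := (PiLp.norm_apply_le (unitDir l) 2).trans (norm_unitDir_le l)
  have h2 : |r * (u ^ 2 - v ^ 2) * unitDir l 2| < 1 := by
    rw [abs_mul, abs_mul, abs_of_nonneg hr]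
    calc r * |u ^ 2 - v ^ 2| * |unitDir l 2| ≤ 1 * |u ^ 2 - v ^ 2| * 1 := by gcongr
      _ < 1 := by linarith
  have := (abs_lt.mp h2).1
  unfold hiddenDensity
  linarith

@[fun_prop]
lemma measurable_hiddenDensity (r u v : ℝ) : Measurable (hiddenDensity r u v) := by
  unfold hiddenDensity
  fun_prop

@[fun_prop]
lemma measurable_jointDensity (r u v : ℝ) (x y : Direction) (ab : ℤˣ × ℤˣ) :
    Measurable fun l => jointDensity r u v l x y ab := by
  unfold jointDensity
  fun_prop

lemma integrable_jointDensity (r u v : ℝ) (x y : Direction) (ab : ℤˣ × ℤˣ) :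
    Integrable (fun l => jointDensity r u v l x y ab) ballMeasure := by
  unfold jointDensity
  exact (((integrable_inner _).abs.add (integrable_inner _)).const_mul _).add
    (((integrable_const _).sub
      ((integrable_finsetSum _ fun _ _ => (integrable_inner _).abs).const_mul _)).const_mul _)

lemma integral_inner (v : Vec3) : ∫ l, inner ℝ v (unitDir l) ∂ballMeasure = 0 :=
  integral_unitDir_odd (f := fun w => inner ℝ v w) fun w => inner_neg_right v w

lemma integral_jointDensity {r u v : ℝ} (huv : u ^ 2 + v ^ 2 = 1) (x y : Direction)
    (ab : ℤˣ × ℤˣ) :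
    ∫ l, jointDensity r u v l x y ab ∂ballMeasure =
      r * meanAbs * ‖steeredVec u v x y ab‖ + zeroWeight x y ab * (1 - r * meanAbs) := by
  have hs : Integrable (fun l => ∑ ab', |inner ℝ (steeredVec u v x y ab') (unitDir l)|)
      ballMeasure := integrable_finsetSum _ fun _ _ => (integrable_inner _).abs
  have hV : Integrable (fun l => |inner ℝ (steeredVec u v x y ab) (unitDir l)| +
      inner ℝ (steeredVec u v x y ab) (unitDir l)) ballMeasure :=
    (integrable_inner _).abs.add (integrable_inner _)
  have hc : Integrable (fun l => 1 - r * ∑ ab', |inner ℝ (steeredVec u v x y ab') (unitDir l)|)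
      ballMeasure := (integrable_const _).sub (hs.const_mul _)
  unfold jointDensity
  rw [integral_add (hV.const_mul _) (hc.const_mul _), integral_const_mul,
    integral_add (integrable_inner _).abs (integrable_inner _), integral_const_mul,
    integral_sub (integrable_const _) (hs.const_mul _), integral_const_mul,
    integral_finsetSum _ fun _ _ => (integrable_inner _).abs, integral_inner]
  simp only [integral_abs_inner, ← Finset.mul_sum, sum_norm_steeredVec huv]
  simp
  ring

/-- Only the odd part of the joint density correlates with the sign of `⟨z, λ⟩`. -/
lemma integral_jointDensity_mul_sign (r u v : ℝ) (x y z : Direction) (ab : ℤˣ × ℤˣ) :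
    ∫ l, jointDensity r u v l x y ab * Real.sign (inner ℝ z.1 (unitDir l)) ∂ballMeasure =
      r * meanAbs * inner ℝ (steeredVec u v x y ab) z.1 := by
  have hz : ‖z.1‖ = 1 := by simp
  have hS : Measurable fun l : Vec3 => Real.sign (inner ℝ z.1 (unitDir l)) :=
    measurable_real_sign.comp (by fun_prop)
  set V := steeredVec u v x y ab with hV
  have hi : Integrable (fun l => inner ℝ V (unitDir l) * Real.sign (inner ℝ z.1 (unitDir l)))
      ballMeasure :=
    (integrable_inner V).mul_bdd (c := 1) hS.aestronglyMeasurable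
      (Filter.Eventually.of_forall fun l => abs_real_sign_le _)
  have hj : Integrable (fun l => jointDensity r u v l x y ab *
      Real.sign (inner ℝ z.1 (unitDir l))) ballMeasure :=
    (integrable_jointDensity r u v x y ab).mul_bdd (c := 1) hS.aestronglyMeasurable
      (Filter.Eventually.of_forall fun l => abs_real_sign_le _)
  have hodd := integral_unitDir_odd (f := fun w =>
    (r * |inner ℝ V w| + zeroWeight x y ab * (1 - r * ∑ ab', |inner ℝ (steeredVec u v x y ab') w|)) *
      Real.sign (inner ℝ z.1 w)) (fun w => by
        simp only [inner_neg_right, abs_neg, Real.sign_neg, mul_neg])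
  have hd : ∀ l, (r * |inner ℝ V (unitDir l)| + zeroWeight x y ab *
      (1 - r * ∑ ab', |inner ℝ (steeredVec u v x y ab') (unitDir l)|)) *
      Real.sign (inner ℝ z.1 (unitDir l)) = jointDensity r u v l x y ab *
        Real.sign (inner ℝ z.1 (unitDir l)) -
        r * (inner ℝ V (unitDir l) * Real.sign (inner ℝ z.1 (unitDir l))) := by
    intro l
    rw [jointDensity, ← hV]
    ring
  simp only [hd] at hodd
  rw [integral_sub hj (hi.const_mul r), integral_const_mul, integral_inner_mul_sign V hz] at hodd
  linarith

/-- The response of qubit `C`: the sign of the hidden direction along the measured one (a fair coin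
where that vanishes). -/
noncomputable def signResponse (l : Vec3) (z : Direction) (c : ℤˣ) : ℝ :=
  (1 + ((c : ℤ) : ℝ) * Real.sign (inner ℝ z.1 (unitDir l))) / 2

lemma isLocalResponse_signResponse : IsLocalResponse signResponse := by
  refine ⟨fun l z => ⟨fun c => ?_, ?_⟩, fun z c => ?_⟩
  · have h := abs_le.mp (abs_real_sign_le (inner ℝ z.1 (unitDir l)))
    unfold signResponse
    rcases Int.units_eq_one_or c with rfl | rfl <;> simp <;> linarith
  · rw [sum_intUnits]
    simp [signResponse]
    ring
  · have hS : Measurable fun l : Vec3 => Real.sign (inner ℝ z.1 (unitDir l)) :=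
      measurable_real_sign.comp (by fun_prop)
    unfold signResponse
    fun_prop

/-- A bi-local model in which `A`, `B` share a joint response and `C` measures the sign of a hidden
direction. It needs `p` to be at most the mean of `|⟨e, λ⟩|`. -/
theorem admitsBiLHV_coreOp {p u v : ℝ} (hp : 0 ≤ p) (hpm : p ≤ meanAbs) (huv : u ^ 2 + v ^ 2 = 1)
    (huv' : |u ^ 2 - v ^ 2| < 1) :
    AdmitsBiLHV (coreOp p u v ((1 - p) / 2) ((1 - p) / 2)) := by
  have hm : 0 < meanAbs := lt_of_lt_of_le (by norm_num) le_meanAbs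
  set r := p / meanAbs with hr_def
  have hr : 0 ≤ r := by positivity
  have hr1 : r ≤ 1 := (div_le_one hm).mpr hpm
  have hrm : r * meanAbs = p := div_mul_cancel₀ _ hm.ne'
  have hpos := hiddenDensity_pos hr hr1 huv'
  have hunif : IsPairResponse fun (_ : Vec3) (_ _ : Direction) (_ : ℤˣ × ℤˣ) => (1 / 4 : ℝ) := by
    refine ⟨fun _ _ _ => ⟨fun _ => by norm_num, ?_⟩, fun _ _ _ => measurable_const⟩
    rw [sum_pairs]
    norm_num
  have hpair : IsPairResponse fun l x y ab =>
      jointDensity r u v l x y ab / hiddenDensity r u v l := by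
    refine ⟨fun l x y => ⟨fun ab => ?_, ?_⟩, fun x y ab => by fun_prop⟩
    · exact div_nonneg (jointDensity_nonneg hr hr1 huv l x y ab) (hpos l).le
    · rw [← Finset.sum_div, sum_jointDensity, div_self (hpos l).ne']
  have hmass : ∫ l, hiddenDensity r u v l ∂ballMeasure = 1 := by
    have hodd := integral_unitDir_odd (f := fun w => r * (u ^ 2 - v ^ 2) * w 2) (by simp)
    have hi : Integrable (fun l : Vec3 => r * (u ^ 2 - v ^ 2) * unitDir l 2) ballMeasure := by
      have := (integrable_inner (EuclideanSpace.single (2 : Fin 3) 1)).const_mul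
        (r * (u ^ 2 - v ^ 2))
      simpa [EuclideanSpace.inner_single_left] using this
    unfold hiddenDensity
    rw [integral_add (integrable_const _) hi, hodd]
    simp
  have hint : Integrable (hiddenDensity r u v) ballMeasure := by
    by_contra hcon
    rw [integral_undef hcon] at hmass
    exact zero_ne_one hmass
  set q := ballMeasure.withDensity fun l => ENNReal.ofReal (hiddenDensity r u v l) with hq
  have hqm : q Set.univ = 1 := by
    rw [hq, withDensity_apply _ MeasurableSet.univ, Measure.restrict_univ,
      ← ofReal_integral_eq_lintegral_ofReal hint (Filter.Eventually.of_forall fun l => (hpos l).le),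
      hmass, ENNReal.ofReal_one]
  -- Only the splitting `AB|C` has positive weight; the responses of the other terms are arbitrary.
  refine ⟨Vec3, inferInstance, q, 0, 0, _, _, _, signResponse, signResponse, signResponse, ?_,
    hpair, hunif, hunif, isLocalResponse_signResponse, isLocalResponse_signResponse,
    isLocalResponse_signResponse, ?_⟩
  · simp [hqm]
  intro x y z a b c
  have hS : Measurable fun l : Vec3 => Real.sign (inner ℝ z.1 (unitDir l)) :=
    measurable_real_sign.comp (by fun_prop)
  have hj := integrable_jointDensity r u v x y (a, b)
  have hjS : Integrable (fun l => jointDensity r u v l x y (a, b) *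
      Real.sign (inner ℝ z.1 (unitDir l))) ballMeasure :=
    hj.mul_bdd (c := 1) hS.aestronglyMeasurable
      (Filter.Eventually.of_forall fun l => abs_real_sign_le _)
  have h1 : ∫ l, jointDensity r u v l x y (a, b) / hiddenDensity r u v l * signResponse l z c ∂q =
      ∫ l, (1 / 2 * jointDensity r u v l x y (a, b) + ((c : ℤ) : ℝ) / 2 *
        (jointDensity r u v l x y (a, b) * Real.sign (inner ℝ z.1 (unitDir l)))) ∂ballMeasure := by
    rw [hq, integral_withDensity_eq_integral_toReal_smul (by fun_prop)
      (Filter.Eventually.of_forall fun _ => ENNReal.ofReal_lt_top)]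
    congr 1
    funext l
    have := (hpos l).ne'
    rw [ENNReal.toReal_ofReal (hpos l).le, smul_eq_mul, signResponse]
    field_simp
  rw [h1, integral_add (hj.const_mul _) (hjS.const_mul _), integral_const_mul, integral_const_mul,
    integral_jointDensity huv, integral_jointDensity_mul_sign, hrm, bornProb_coreOp]
  simp
  ring

lemma admitsBiLHV_rhoChi {p : ℝ} (hp : 0 ≤ p) (hp1 : p ≤ 0.4167) :
    AdmitsBiLHV (rhoChi p (Real.pi / 8)) := by
  rw [rhoChi_eq_coreOp]
  refine admitsBiLHV_coreOp hp (le_trans ?_ le_meanAbs) (Real.cos_sq_add_sin_sq _) ?_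
  · exact hp1.trans (by norm_num)
  · rw [cos_pi_div_eight_sq, sin_pi_div_eight_sq, abs_lt]
    constructor <;> linarith [sqrt_two_lt_two, Real.sqrt_nonneg 2]

lemma threshold_lt : (4 - √2) / 7 < (0.3697 : ℝ) := by
  have : (1.4142 : ℝ) < √2 := by
    rw [Real.lt_sqrt (by norm_num)]
    norm_num
  linarith

/-- Above the threshold, suitable diagonal filters reveal genuine tripartite nonlocality. -/
lemma exists_filter_genuinelyNonlocal {p : ℝ} (hp : 0.3697 ≤ p) (hp1 : p ≤ 1) :
    ∃ FA FB FC : Op1, IsLocalFilter FA FB FC (rhoChi p (Real.pi / 8)) ∧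
      ViolatesSvetlichny (filtered FA FB FC (rhoChi p (Real.pi / 8))) ∧
      GenuinelyNonlocal (filtered FA FB FC (rhoChi p (Real.pi / 8))) := by
  have hp0 : 0 ≤ p := le_trans (by norm_num) hp
  obtain ⟨x, y, z, -, -, -, hF, hv⟩ :=
    (exists_diagFilter_iff hp0 hp1).mpr (threshold_lt.trans_le hp)
  exact ⟨_, _, _, hF, hv, genuinelyNonlocal_of_violates (trace_obs_mul_filtered p x y z) hv⟩

end ThreeQubit

theorem mainTheorem2 :
    -- a bi-LHV model before filtering
    (∀ p : ℝ, 0 ≤ p → p ≤ 0.4167 →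
      ThreeQubit.AdmitsBiLHV (ThreeQubit.rhoChi p (Real.pi / 8))) ∧
    -- the maximal value before filtering is `4p`, so there is never a violation
    (∀ p : ℝ, 0 ≤ p → p ≤ 1 →
      IsGreatest (ThreeQubit.svetlichnyValues (ThreeQubit.rhoChi p (Real.pi / 8))) (4 * p) ∧
      ¬ ThreeQubit.ViolatesSvetlichny (ThreeQubit.rhoChi p (Real.pi / 8))) ∧
    -- violation and genuine nonlocality after suitable local filtering
    (∀ p : ℝ, 0.3697 ≤ p → p ≤ 1 → ∃ FA FB FC : ThreeQubit.Op1,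
      ThreeQubit.IsLocalFilter FA FB FC (ThreeQubit.rhoChi p (Real.pi / 8)) ∧
      ThreeQubit.ViolatesSvetlichny
        (ThreeQubit.filtered FA FB FC (ThreeQubit.rhoChi p (Real.pi / 8))) ∧
      ThreeQubit.GenuinelyNonlocal
        (ThreeQubit.filtered FA FB FC (ThreeQubit.rhoChi p (Real.pi / 8)))) ∧
    -- hidden genuine nonlocality
    (∀ p : ℝ, 0.3697 ≤ p → p ≤ 0.4167 →
      ThreeQubit.AdmitsBiLHV (ThreeQubit.rhoChi p (Real.pi / 8)) ∧
      ∃ FA FB FC : ThreeQubit.Op1,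
        ThreeQubit.IsLocalFilter FA FB FC (ThreeQubit.rhoChi p (Real.pi / 8)) ∧
        ThreeQubit.ViolatesSvetlichny
          (ThreeQubit.filtered FA FB FC (ThreeQubit.rhoChi p (Real.pi / 8))) ∧
        ThreeQubit.GenuinelyNonlocal
          (ThreeQubit.filtered FA FB FC (ThreeQubit.rhoChi p (Real.pi / 8)))) ∧
    -- the exact threshold for the diagonal filters, slightly below the numerical value `0.3697`
    (∀ p : ℝ, 0 ≤ p → p ≤ 1 →
      ((∃ x y z : ℝ, 0 ≤ x ∧ 0 ≤ y ∧ 0 ≤ z ∧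
        ThreeQubit.IsLocalFilter (ThreeQubit.diagFilter x) (ThreeQubit.diagFilter y)
          (ThreeQubit.diagFilter z) (ThreeQubit.rhoChi p (Real.pi / 8)) ∧
        ThreeQubit.ViolatesSvetlichny
          (ThreeQubit.filtered (ThreeQubit.diagFilter x) (ThreeQubit.diagFilter y)
            (ThreeQubit.diagFilter z) (ThreeQubit.rhoChi p (Real.pi / 8)))) ↔
        (4 - Real.sqrt 2) / 7 < p)) := by
  refine ⟨fun p hp hp1 => ThreeQubit.admitsBiLHV_rhoChi hp hp1, fun p hp hp1 => ?_,
    fun p hp hp1 => ThreeQubit.exists_filter_genuinelyNonlocal hp hp1, fun p hp hp1 => ?_,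
    fun p hp hp1 => ThreeQubit.exists_diagFilter_iff hp hp1⟩
  · have h := ThreeQubit.isGreatest_svetlichnyValues_rhoChi hp
    refine ⟨h, ?_⟩
    rintro ⟨v, hv, hlt⟩
    have := h.2 hv
    linarith
  · exact ⟨ThreeQubit.admitsBiLHV_rhoChi (le_trans (by norm_num) hp) hp1,
      ThreeQubit.exists_filter_genuinelyNonlocal hp (hp1.trans (by norm_num))⟩
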